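/- Let $l\ge 0$ and $\gamma=2$ (rotating shallow water). For the density $\varrho$, pressure $p$, entropy $S$ and velocity ${\bf u}$ consider in $\mathbb R^2$ the system $$\partial_t(\varrho{\bf u})+\mathrm{div}(\varrho{\bf u}\otimes{\bf u})+\varrho\, l\,{\mathcal L}{\bf u}+\nabla p=0,\quad \partial_t\varrho+\mathrm{div}(\varrho{\bf u})=0,\quad \partial_t S+{\bf u}\cdot\nabla S=0,\quad p=e^{S}\varrho^{\gamma},$$ where ${\mathcal L}=\begin{pmatrix}0&-1\\1&0\end{pmatrix}$, with initial data ${\bf u}_0,\varrho_0,p_0\in C^1(\mathbb R^2)$ such that $\varrho_0,p_0>0$ and $({\bf u}_0,\varrho_0,p_0)=({\bf 0},\bar\varrho,\bar p)$ for $|{\bf x}|\ge R$, with constants $R,\bar\varrho,\bar p>0$. A classical solution on $[0,T]$ is a solution $(\varrho,p,S,{\bf u})$ in $C^1([0,T]\times\mathbb R^2)$ with $\varrho>0$ that attains the data at $t=0$. Put $\sigma=\sqrt{\gamma\bar p/\bar\varrho}$, $B_R(t)=\{|{\bf x}|<R+\sigma t\}$, ${\bf x}_\perp=(x_2,-x_1)$.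 Define the following constants from the initial data, all integrals being over $B_R(0)$: $$G_0=\tfrac12\int|{\bf x}|^2\varrho_0,\quad F_1=\int\varrho_0{\bf u}_0\cdot{\bf x},\quad F_2=\int\varrho_0{\bf u}_0\cdot{\bf x}_\perp,\quad e=\tfrac12\int\varrho_0|{\bf u}_0|^2+\frac1{\gamma-1}\int(p_0-\bar p),$$ $$m=\int(\varrho_0-\bar\varrho),\quad {\bf P}_0=\int\varrho_0{\bf x},\quad (I_1,I_2)=\int\varrho_0{\bf u}_0,\quad A_0=2(\gamma-1)e+l^2G_0-lF_2.$$ For $l>0$ let $$G(t)=\tfrac14\sigma^4\bar\varrho\pi t^4+\sigma^3\bar\varrho\pi R t^3+\tfrac32\sigma^2\bar\varrho\pi R^2t^2+\sigma\bar\varrho\pi R^3t+\frac{F_1}{l}\sin lt+\Big(G_0-\frac{A_0}{l^2}\Big)\cos lt+\frac{A_0}{l^2};$$ for $l=0$ replace the last three terms by their limit $F_1t+G_0+\tfrac12A_0t^2$. Let also $${\bf P}(t)={\bf P}_0+\int_0^t\big(I_1\cos l\tau+I_2\sin l\tau,\; I_2\cos l\tau-I_1\sin l\tau\big)\,d\tau,$$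 $$\phi_-(t)=\frac{|{\bf P}(t)|^2}{2\,(m+\pi\bar\varrho(R+\sigma t)^2)},\qquad \phi_+(t)=\frac{(R+\sigma t)^2}{2}\,\big(m+\pi\bar\varrho(R+\sigma t)^2\big).$$ (i) For every $T>0$, every classical solution on $[0,T]$ and every $t\in[0,T]$, $$\tfrac12\int_{B_R(t)}|{\bf x}|^2\varrho\,dV=G(t),\qquad \int_{B_R(t)}\varrho\,{\bf x}\,dV={\bf P}(t).$$ (ii) If $T_*>0$ and $G(T_*)=\phi_-(T_*)$ or $G(T_*)=\phi_+(T_*)$, then the classical solution loses smoothness before $T_*$: there is $T\in(0,T_*)$ such that the Cauchy problem has no classical solution on $[0,T]$. -/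

import Mathlib

open MeasureTheory Metric

namespace RotatingGas

noncomputable section

/-- The plane `ℝ²` with its Euclidean norm. -/
abbrev Plane : Type := EuclideanSpace ℝ (Fin 2)

/-- The matrix `𝓛 = (0 -1; 1 0)` of the Coriolis term, applied to a vector. -/
def rot (v : Plane) : Plane := !₂[-v 1, v 0]

/-- `x_⊥ = (x₂, -x₁)`. -/
def perp (x : Plane) : Plane := !₂[x 1, -x 0]

/-- Time derivative at `(t, x)`. -/
def dt (f : ℝ → Plane → ℝ) (t : ℝ) (x : Plane) : ℝ := deriv (fun s => f s x) t

/-- Partial derivative in the direction of the `j`-th coordinate at `x`. -/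
def dx (j : Fin 2) (f : Plane → ℝ) (x : Plane) : ℝ :=
  fderiv ℝ f x (EuclideanSpace.single j 1)

/-- `(ρ, p, S, u)` (density, pressure, entropy, velocity) is a classical, that is `C¹`, solution on
`[0, T] × ℝ²` of the equations of two-dimensional rotational gas dynamics with heat ratio `γ` and
Coriolis parameter `l`. The differential equations are required for `0 < t < T`; by continuity of
the first derivatives they then hold up to the end points, with one-sided time derivatives. -/
structure IsClassicalSolution (γ l T : ℝ) (ρ p S : ℝ → Plane → ℝ) (u : ℝ → Plane → Plane) :
    Prop where
  contDiff_density :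
    ContDiffOn ℝ 1 (fun z : ℝ × Plane => ρ z.1 z.2) (Set.Icc 0 T ×ˢ Set.univ)
  contDiff_pressure :
    ContDiffOn ℝ 1 (fun z : ℝ × Plane => p z.1 z.2) (Set.Icc 0 T ×ˢ Set.univ)
  contDiff_entropy :
    ContDiffOn ℝ 1 (fun z : ℝ × Plane => S z.1 z.2) (Set.Icc 0 T ×ˢ Set.univ)
  contDiff_velocity :
    ContDiffOn ℝ 1 (fun z : ℝ × Plane => u z.1 z.2) (Set.Icc 0 T ×ˢ Set.univ)
  density_pos : ∀ t ∈ Set.Icc 0 T, ∀ x, 0 < ρ t x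
  momentum : ∀ t ∈ Set.Ioo 0 T, ∀ x, ∀ i : Fin 2,
    dt (fun s y => ρ s y * u s y i) t x + ∑ j : Fin 2, dx j (fun y => ρ t y * u t y i * u t y j) x
      + ρ t x * l * rot (u t x) i + dx i (p t) x = 0
  continuity : ∀ t ∈ Set.Ioo 0 T, ∀ x,
    dt ρ t x + ∑ j : Fin 2, dx j (fun y => ρ t y * u t y j) x = 0
  entropy : ∀ t ∈ Set.Ioo 0 T, ∀ x,
    dt S t x + ∑ j : Fin 2, u t x j * dx j (S t) x = 0
  state : ∀ t ∈ Set.Icc 0 T, ∀ x, p t x = Real.exp (S t x) * ρ t x ^ γ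

/-- Initial data: `C¹` fields with positive density and pressure which coincide with the constant
state `(u, ρ, p) = (0, ρbar, pbar)` outside the ball of radius `R` about the origin. -/
structure CauchyData where
  R : ℝ
  R_pos : 0 < R
  ρbar : ℝ
  ρbar_pos : 0 < ρbar
  pbar : ℝ
  pbar_pos : 0 < pbar
  ρ₀ : Plane → ℝ
  p₀ : Plane → ℝ
  u₀ : Plane → Plane
  contDiff_ρ₀ : ContDiff ℝ 1 ρ₀
  contDiff_p₀ : ContDiff ℝ 1 p₀
  contDiff_u₀ : ContDiff ℝ 1 u₀
  ρ₀_pos : ∀ x, 0 < ρ₀ x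
  p₀_pos : ∀ x, 0 < p₀ x
  ρ₀_outside : ∀ x, x ∉ ball (0 : Plane) R → ρ₀ x = ρbar
  p₀_outside : ∀ x, x ∉ ball (0 : Plane) R → p₀ x = pbar
  u₀_outside : ∀ x, x ∉ ball (0 : Plane) R → u₀ x = 0

/-- The classical solution attains the Cauchy data at time `0`. -/
structure SolvesCauchyProblem (γ l T : ℝ) (d : CauchyData) (ρ p S : ℝ → Plane → ℝ)
    (u : ℝ → Plane → Plane) : Prop where
  isClassicalSolution : IsClassicalSolution γ l T ρ p S u
  initial_density : ∀ x, ρ 0 x = d.ρ₀ x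
  initial_pressure : ∀ x, p 0 x = d.p₀ x
  initial_velocity : ∀ x, u 0 x = d.u₀ x

/-! Functionals of the fields at a fixed time, over the ball of radius `r` about the origin. -/

/-- `½ ∫ |x|² ρ`. -/
def secondMoment (r : ℝ) (ρ : Plane → ℝ) : ℝ :=
  1 / 2 * ∫ x in ball (0 : Plane) r, ‖x‖ ^ 2 * ρ x

/-- `∫ ρ x`. -/
def firstMoment (r : ℝ) (ρ : Plane → ℝ) : Plane :=
  ∫ x in ball (0 : Plane) r, ρ x • x

/-- `∫ ρ u`. -/
def totalMomentum (r : ℝ) (ρ : Plane → ℝ) (u : Plane → Plane) : Plane :=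
  ∫ x in ball (0 : Plane) r, ρ x • u x

/-- `∫ ρ u · x`. -/
def radialMomentum (r : ℝ) (ρ : Plane → ℝ) (u : Plane → Plane) : ℝ :=
  ∫ x in ball (0 : Plane) r, ρ x * inner ℝ (u x) x

/-- `∫ ρ u · x_⊥`. -/
def angularMomentum (r : ℝ) (ρ : Plane → ℝ) (u : Plane → Plane) : ℝ :=
  ∫ x in ball (0 : Plane) r, ρ x * inner ℝ (u x) (perp x)

/-- `½ ∫ ρ |u|²`. -/
def kineticEnergy (r : ℝ) (ρ : Plane → ℝ) (u : Plane → Plane) : ℝ :=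
  1 / 2 * ∫ x in ball (0 : Plane) r, ρ x * ‖u x‖ ^ 2

/-- Kinetic energy plus `1/(γ-1) ∫ (p - pbar)`. -/
def totalEnergy (γ pbar r : ℝ) (ρ p : Plane → ℝ) (u : Plane → Plane) : ℝ :=
  kineticEnergy r ρ u + 1 / (γ - 1) * ∫ x in ball (0 : Plane) r, (p x - pbar)

/-- `∫ (ρ - ρbar)`. -/
def massExcess (ρbar r : ℝ) (ρ : Plane → ℝ) : ℝ :=
  ∫ x in ball (0 : Plane) r, (ρ x - ρbar)

namespace CauchyData

/-- Sound speed of the constant state: the square root of `∂p/∂ρ = γ exp(S) ρ ^ (γ - 1) = γ p / ρ`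
at `(ρbar, pbar)`. -/
def soundSpeed (γ : ℝ) (d : CauchyData) : ℝ := Real.sqrt (γ * d.pbar / d.ρbar)

/-- Radius `R + σ t` of the expanding ball. -/
def radius (γ : ℝ) (d : CauchyData) (t : ℝ) : ℝ := d.R + d.soundSpeed γ * t

/-- `A₀ = 2 (γ - 1) e(0) + l² G(0) - l F₂(0)`. -/
def A₀ (γ l : ℝ) (d : CauchyData) : ℝ :=
  2 * (γ - 1) * totalEnergy γ d.pbar d.R d.ρ₀ d.p₀ d.u₀ + l ^ 2 * secondMoment d.R d.ρ₀
    - l * angularMomentum d.R d.ρ₀ d.u₀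

/-- The explicit function `G` for `γ = 2`, computed from the data. For `l = 0` the part containing
`1 / l` is replaced by its limit as `l → 0`. -/
def G (l : ℝ) (d : CauchyData) (t : ℝ) : ℝ :=
  let σ := d.soundSpeed 2
  let G₀ := secondMoment d.R d.ρ₀
  let F₁ := radialMomentum d.R d.ρ₀ d.u₀
  let A := d.A₀ 2 l
  1 / 4 * σ ^ 4 * d.ρbar * Real.pi * t ^ 4 + σ ^ 3 * d.ρbar * Real.pi * d.R * t ^ 3
    + 3 / 2 * σ ^ 2 * d.ρbar * Real.pi * d.R ^ 2 * t ^ 2 + σ * d.ρbar * Real.pi * d.R ^ 3 * t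
    + if l = 0 then F₁ * t + G₀ + A / 2 * t ^ 2
      else F₁ / l * Real.sin (l * t) + (G₀ - A / l ^ 2) * Real.cos (l * t) + A / l ^ 2

/-- The solution `I` of `I' = - l 𝓛 I` whose value at `0` is the initial total momentum. -/
def I (l : ℝ) (d : CauchyData) (t : ℝ) : Plane :=
  let I₀ := totalMomentum d.R d.ρ₀ d.u₀
  !₂[I₀ 0 * Real.cos (l * t) + I₀ 1 * Real.sin (l * t),
    I₀ 1 * Real.cos (l * t) - I₀ 0 * Real.sin (l * t)]

/-- `P(t) = P(0) + ∫₀ᵗ I(τ) dτ`, with `P(0)` the initial first moment. -/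
def P (l : ℝ) (d : CauchyData) (t : ℝ) : Plane :=
  firstMoment d.R d.ρ₀ + ∫ τ in (0 : ℝ)..t, d.I l τ

/-- `m(0) + π ρbar (R + σ t)²`. -/
def mass (γ : ℝ) (d : CauchyData) (t : ℝ) : ℝ :=
  massExcess d.ρbar d.R d.ρ₀ + Real.pi * d.ρbar * d.radius γ t ^ 2

/-- The lower bound `φ₋`. -/
def φlower (γ l : ℝ) (d : CauchyData) (t : ℝ) : ℝ := ‖d.P l t‖ ^ 2 / (2 * d.mass γ t)

/-- The upper bound `φ₊`. -/
def φupper (γ : ℝ) (d : CauchyData) (t : ℝ) : ℝ := d.radius γ t ^ 2 / 2 * d.mass γ t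

end CauchyData

end

end RotatingGas

namespace RotatingGas

open Set Filter Topology

/-- The `j`-th standard basis vector of the plane. -/
noncomputable def basisVec (j : Fin 2) : Plane := EuclideanSpace.single j 1

theorem integral_fderiv_eq_zero_of_compact_support {k : Set Plane} (hk : IsCompact k)
    {f : Plane → ℝ} (hf : ContDiff ℝ 1 f) (h0 : ∀ x ∉ k, f x = 0) (v : Plane) :
    Integrable (fun x => fderiv ℝ f x v) ∧ ∫ x, fderiv ℝ f x v = 0 := by
  have hfc : HasCompactSupport f := HasCompactSupport.intro hk h0
  have hc : Continuous fun x => fderiv ℝ f x v := by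
    have := hf.continuous_fderiv one_ne_zero
    fun_prop
  have hi : Integrable fun x => fderiv ℝ f x v :=
    hc.integrable_of_hasCompactSupport (hfc.fderiv_apply (𝕜 := ℝ) v)
  refine ⟨hi, ?_⟩
  have h := integral_mul_fderiv_eq_neg_fderiv_mul_of_integrable (𝕜 := ℝ) (μ := volume)
    (f := fun _ : Plane => (1 : ℝ)) (g := f) (v := v) (by simp) (by simpa using hi)
    (by simpa using hf.continuous.integrable_of_hasCompactSupport hfc)
    (fun x _ => by fun_prop) (fun x _ => (hf.differentiable one_ne_zero) x)
  simpa using h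

section Slices

variable {a b t : ℝ} {q : ℝ × Plane → ℝ}

theorem isOpen_strip (a b : ℝ) : IsOpen (Ioo a b ×ˢ (univ : Set Plane)) :=
  isOpen_Ioo.prod isOpen_univ

theorem contDiffAt_of_mem_Ioo (hq : ContDiffOn ℝ 1 q (Icc a b ×ˢ univ)) (ht : t ∈ Ioo a b)
    (x : Plane) : ContDiffAt ℝ 1 q (t, x) :=
  hq.contDiffAt (mem_of_superset ((isOpen_strip a b).mem_nhds ⟨ht, mem_univ x⟩)
    (prod_mono Ioo_subset_Icc_self subset_rfl))

theorem hasFDerivAt_of_mem_Ioo (hq : ContDiffOn ℝ 1 q (Icc a b ×ˢ univ)) (ht : t ∈ Ioo a b)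
    (x : Plane) : HasFDerivAt q (fderiv ℝ q (t, x)) (t, x) :=
  ((contDiffAt_of_mem_Ioo hq ht x).differentiableAt one_ne_zero).hasFDerivAt

theorem hasDerivAt_slice_time {L : ℝ × Plane →L[ℝ] ℝ} {x : Plane} (h : HasFDerivAt q L (t, x)) :
    HasDerivAt (fun s => q (s, x)) (L (1, 0)) t := by
  have h1 : HasDerivAt (fun s : ℝ => (s, x)) ((1 : ℝ), (0 : Plane)) t :=
    (hasDerivAt_id t).prodMk (hasDerivAt_const t x)
  exact h.comp_hasDerivAt t h1

theorem hasFDerivAt_slice_space {L : ℝ × Plane →L[ℝ] ℝ} {x : Plane} (h : HasFDerivAt q L (t, x)) :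
    HasFDerivAt (fun y => q (t, y)) (L.comp (ContinuousLinearMap.inr ℝ ℝ Plane)) x :=
  h.comp x (hasFDerivAt_prodMk_right t x)

theorem contDiff_slice_space (hq : ContDiffOn ℝ 1 q (Icc a b ×ˢ univ)) (ht : t ∈ Icc a b) :
    ContDiff ℝ 1 fun x => q (t, x) := by
  rw [← contDiffOn_univ]
  exact hq.comp (by fun_prop) fun x _ => ⟨ht, mem_univ x⟩

theorem continuousOn_fderiv_strip (hq : ContDiffOn ℝ 1 q (Icc a b ×ˢ univ)) :
    ContinuousOn (fderiv ℝ q) (Ioo a b ×ˢ univ) :=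
  (hq.mono (prod_mono Ioo_subset_Icc_self subset_rfl)).continuousOn_fderiv_of_isOpen
    (isOpen_strip a b) le_rfl

theorem continuousOn_integral_slice {k : Set Plane} (hk : IsCompact k)
    (hq : ContDiffOn ℝ 1 q (Icc a b ×ˢ univ)) (h0 : ∀ t ∈ Icc a b, ∀ x ∉ k, q (t, x) = 0) :
    ContinuousOn (fun t => ∫ x, q (t, x)) (Icc a b) :=
  continuousOn_integral_of_compact_support (f := fun t x => q (t, x)) hk hq.continuousOn
    fun t x ht hx => h0 t ht x hx

theorem hasDerivAt_integral_slice {k : Set Plane} (hk : IsCompact k)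
    (hq : ContDiffOn ℝ 1 q (Icc a b ×ˢ univ)) (h0 : ∀ t ∈ Icc a b, ∀ x ∉ k, q (t, x) = 0)
    (ht : t ∈ Ioo a b) :
    Integrable (fun x => fderiv ℝ q (t, x) (1, 0)) ∧
      HasDerivAt (fun s => ∫ x, q (s, x)) (∫ x, fderiv ℝ q (t, x) (1, 0)) t := by
  obtain ⟨ε, hε, hball⟩ := Metric.isOpen_iff.1 isOpen_Ioo t ht
  have hsub : closedBall t (ε / 2) ⊆ Ioo a b :=
    (closedBall_subset_ball (by linarith)).trans hball
  have hcont : ContinuousOn (fun z => fderiv ℝ q z ((1 : ℝ), (0 : Plane))) (Ioo a b ×ˢ univ) :=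
    (continuousOn_fderiv_strip hq).clm_apply continuousOn_const
  obtain ⟨C, hC⟩ := ((isCompact_closedBall t (ε / 2)).prod hk).exists_bound_of_continuousOn
    (hcont.mono (prod_mono hsub (subset_univ k)))
  have hslice : ∀ s ∈ Ioo a b, Continuous fun x => fderiv ℝ q (s, x) ((1 : ℝ), (0 : Plane)) := by
    intro s hs
    rw [← continuousOn_univ]
    exact hcont.comp (by fun_prop) fun x _ => ⟨hs, mem_univ x⟩
  have hmem : ∀ s ∈ Ioo a b, s ∈ Icc a b := fun s hs => Ioo_subset_Icc_self hs
  refine hasDerivAt_integral_of_dominated_loc_of_deriv_le (F := fun s x => q (s, x))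
    (F' := fun s x => fderiv ℝ q (s, x) (1, 0)) (bound := k.indicator fun _ => C)
    (closedBall_mem_nhds t (half_pos hε)) ?_ ?_ (hslice t ht).aestronglyMeasurable ?_ ?_ ?_
  · filter_upwards [isOpen_Ioo.mem_nhds ht] with s hs
    exact (contDiff_slice_space hq (hmem s hs)).continuous.aestronglyMeasurable
  · exact (contDiff_slice_space hq (hmem t ht)).continuous.integrable_of_hasCompactSupport
      (HasCompactSupport.intro hk (h0 t (hmem t ht)))
  · refine ae_of_all _ fun x s hs => ?_
    by_cases hx : x ∈ k
    · rw [indicator_of_mem hx]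
      exact hC (s, x) ⟨hs, hx⟩
    · rw [indicator_of_notMem hx]
      have h1 := hasDerivAt_slice_time (hasFDerivAt_of_mem_Ioo hq (hsub hs) x)
      have h2 : HasDerivAt (fun s => q (s, x)) 0 s :=
        (hasDerivAt_const s (0 : ℝ)).congr_of_eventuallyEq (by
          filter_upwards [isOpen_Ioo.mem_nhds (hsub hs)] with r hr
          exact h0 r (hmem r hr) x hx)
      simp [h1.unique h2]
  · exact (integrable_indicator_iff hk.measurableSet).2 (integrableOn_const hk.measure_ne_top)
  · exact ae_of_all _ fun x s hs => hasDerivAt_slice_time (hasFDerivAt_of_mem_Ioo hq (hsub hs) x)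

theorem integral_fderiv_slice_space {k : Set Plane} (hk : IsCompact k)
    (hq : ContDiffOn ℝ 1 q (Icc a b ×ˢ univ)) (h0 : ∀ t ∈ Icc a b, ∀ x ∉ k, q (t, x) = 0)
    (ht : t ∈ Ioo a b) (v : Plane) :
    Integrable (fun x => fderiv ℝ q (t, x) (0, v)) ∧ ∫ x, fderiv ℝ q (t, x) (0, v) = 0 := by
  have ht' := Ioo_subset_Icc_self ht
  have h := integral_fderiv_eq_zero_of_compact_support hk (contDiff_slice_space hq ht')
    (h0 t ht') v
  have he : ∀ x, fderiv ℝ (fun y => q (t, y)) x v = fderiv ℝ q (t, x) (0, v) := fun x => by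
    rw [(hasFDerivAt_slice_space (hasFDerivAt_of_mem_Ioo hq ht x)).fderiv]; simp
  simpa only [he] using h

end Slices

/-- Integral form of a balance law `∂ₜ q + ∂₀ f₀ + ∂₁ f₁ = g` with spatially compactly supported
density `q` and fluxes `f₀, f₁`. -/
theorem hasDerivAt_integral_of_balance {a b t : ℝ} {k : Set Plane} (hk : IsCompact k)
    {q f₀ f₁ : ℝ × Plane → ℝ}
    (hq : ContDiffOn ℝ 1 q (Icc a b ×ˢ univ)) (q_supp : ∀ t ∈ Icc a b, ∀ x ∉ k, q (t, x) = 0)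
    (hf₀ : ContDiffOn ℝ 1 f₀ (Icc a b ×ˢ univ)) (f₀_supp : ∀ t ∈ Icc a b, ∀ x ∉ k, f₀ (t, x) = 0)
    (hf₁ : ContDiffOn ℝ 1 f₁ (Icc a b ×ˢ univ)) (f₁_supp : ∀ t ∈ Icc a b, ∀ x ∉ k, f₁ (t, x) = 0)
    (ht : t ∈ Ioo a b) {g : Plane → ℝ}
    (hg : ∀ x, fderiv ℝ q (t, x) (1, 0) + fderiv ℝ f₀ (t, x) (0, basisVec 0)
      + fderiv ℝ f₁ (t, x) (0, basisVec 1) = g x) :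
    Integrable g ∧ HasDerivAt (fun s => ∫ x, q (s, x)) (∫ x, g x) t := by
  obtain ⟨i, h⟩ := hasDerivAt_integral_slice hk hq q_supp ht
  obtain ⟨i₀, h₀⟩ := integral_fderiv_slice_space hk hf₀ f₀_supp ht (basisVec 0)
  obtain ⟨i₁, h₁⟩ := integral_fderiv_slice_space hk hf₁ f₁_supp ht (basisVec 1)
  obtain rfl : _ = g := funext hg
  have j : Integrable fun x => fderiv ℝ q (t, x) (1, 0) + fderiv ℝ f₀ (t, x) (0, basisVec 0) :=
    i.add i₀
  refine ⟨j.add i₁, ?_⟩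
  rw [integral_add j i₁, integral_add i i₀, h₀, h₁]
  simpa using h

theorem eq_left_of_hasDerivAt_zero {a b : ℝ} {f : ℝ → ℝ} (hf : ContinuousOn f (Icc a b))
    (hf' : ∀ t ∈ Ioo a b, HasDerivAt f 0 t) : ∀ t ∈ Icc a b, f t = f a := by
  intro t ht
  rcases ht.1.eq_or_lt with rfl | hat
  · rfl
  obtain ⟨c, -, hc⟩ := exists_hasDerivAt_eq_slope f (fun _ => 0) hat
    (hf.mono (Icc_subset_Icc_right ht.2)) fun s hs => hf' s ⟨hs.1, hs.2.trans_le ht.2⟩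
  have : t - a ≠ 0 := by linarith
  field_simp at hc
  linarith

/-- Grönwall's inequality for a nonnegative function vanishing initially. -/
theorem eq_zero_of_deriv_le_mul {a b C : ℝ} {f f' : ℝ → ℝ} (hf : ContinuousOn f (Icc a b))
    (hf' : ∀ t ∈ Ioo a b, HasDerivAt f (f' t) t) (hle : ∀ t ∈ Ioo a b, f' t ≤ C * f t)
    (h0 : ∀ t ∈ Icc a b, 0 ≤ f t) (ha : f a = 0) : ∀ t ∈ Icc a b, f t = 0 := by
  have hd : ∀ t ∈ Ioo a b, HasDerivAt (fun s => f s * Real.exp (-C * s))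
      (f' t * Real.exp (-C * t) + f t * (Real.exp (-C * t) * (-C))) t := fun t ht => by
    have h := ((hasDerivAt_id t).const_mul (-C)).exp
    simpa using (hf' t ht).fun_mul h
  have hanti : AntitoneOn (fun s => f s * Real.exp (-C * s)) (Icc a b) := by
    refine antitoneOn_of_deriv_nonpos (convex_Icc a b) (hf.mul (by fun_prop)) ?_ ?_
    · rw [interior_Icc]
      exact fun t ht => (hd t ht).differentiableAt.differentiableWithinAt
    · rw [interior_Icc]
      intro t ht
      rw [(hd t ht).deriv]
      have := hle t ht
      have h2 := Real.exp_pos (-C * t)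
      nlinarith
  intro t ht
  have h := hanti (left_mem_Icc.2 (ht.1.trans ht.2)) ht ht.1
  simp only [ha, zero_mul] at h
  exact le_antisymm (nonpos_of_mul_nonpos_left h (Real.exp_pos _)) (h0 t ht)

/-- The equations for `γ = 2` in primitive variables, for fields on space-time: density `r`,
pressure `p`, entropy `S` and velocity components `a`, `b`. -/
structure PrimitiveSolution (l T : ℝ) (r p S a b : ℝ × Plane → ℝ) : Prop where
  smooth_r : ContDiffOn ℝ 1 r (Icc 0 T ×ˢ univ)
  smooth_p : ContDiffOn ℝ 1 p (Icc 0 T ×ˢ univ)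
  smooth_S : ContDiffOn ℝ 1 S (Icc 0 T ×ˢ univ)
  smooth_a : ContDiffOn ℝ 1 a (Icc 0 T ×ˢ univ)
  smooth_b : ContDiffOn ℝ 1 b (Icc 0 T ×ˢ univ)
  r_pos : ∀ t ∈ Icc 0 T, ∀ x, 0 < r (t, x)
  state : ∀ t ∈ Icc 0 T, ∀ x, p (t, x) = Real.exp (S (t, x)) * r (t, x) ^ 2
  continuity : ∀ t ∈ Ioo 0 T, ∀ x,
    fderiv ℝ r (t, x) (1, 0) + a (t, x) * fderiv ℝ r (t, x) (0, basisVec 0)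
      + b (t, x) * fderiv ℝ r (t, x) (0, basisVec 1)
      + r (t, x) * (fderiv ℝ a (t, x) (0, basisVec 0) + fderiv ℝ b (t, x) (0, basisVec 1)) = 0
  momentum₀ : ∀ t ∈ Ioo 0 T, ∀ x,
    r (t, x) * (fderiv ℝ a (t, x) (1, 0) + a (t, x) * fderiv ℝ a (t, x) (0, basisVec 0)
      + b (t, x) * fderiv ℝ a (t, x) (0, basisVec 1)) - l * r (t, x) * b (t, x)
      + fderiv ℝ p (t, x) (0, basisVec 0) = 0
  momentum₁ : ∀ t ∈ Ioo 0 T, ∀ x,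
    r (t, x) * (fderiv ℝ b (t, x) (1, 0) + a (t, x) * fderiv ℝ b (t, x) (0, basisVec 0)
      + b (t, x) * fderiv ℝ b (t, x) (0, basisVec 1)) + l * r (t, x) * a (t, x)
      + fderiv ℝ p (t, x) (0, basisVec 1) = 0
  pressure : ∀ t ∈ Ioo 0 T, ∀ x,
    fderiv ℝ p (t, x) (1, 0) + a (t, x) * fderiv ℝ p (t, x) (0, basisVec 0)
      + b (t, x) * fderiv ℝ p (t, x) (0, basisVec 1)
      + 2 * p (t, x) * (fderiv ℝ a (t, x) (0, basisVec 0) + fderiv ℝ b (t, x) (0, basisVec 1)) = 0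
  entropy : ∀ t ∈ Ioo 0 T, ∀ x,
    fderiv ℝ S (t, x) (1, 0) + a (t, x) * fderiv ℝ S (t, x) (0, basisVec 0)
      + b (t, x) * fderiv ℝ S (t, x) (0, basisVec 1) = 0

theorem dt_eq_fderiv {f : ℝ → Plane → ℝ} {t : ℝ} {x : Plane}
    (h : DifferentiableAt ℝ (fun z : ℝ × Plane => f z.1 z.2) (t, x)) :
    dt f t x = fderiv ℝ (fun z : ℝ × Plane => f z.1 z.2) (t, x) (1, 0) :=
  (hasDerivAt_slice_time h.hasFDerivAt).deriv

theorem dx_eq_fderiv (j : Fin 2) {f : ℝ → Plane → ℝ} {t : ℝ} {x : Plane}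
    (h : DifferentiableAt ℝ (fun z : ℝ × Plane => f z.1 z.2) (t, x)) :
    dx j (f t) x = fderiv ℝ (fun z : ℝ × Plane => f z.1 z.2) (t, x) (0, basisVec j) := by
  unfold dx
  rw [(hasFDerivAt_slice_space h.hasFDerivAt).fderiv]
  simp [basisVec]

theorem IsClassicalSolution.primitiveSolution {l T : ℝ} {ρ p S : ℝ → Plane → ℝ}
    {u : ℝ → Plane → Plane} (h : IsClassicalSolution 2 l T ρ p S u) :
    PrimitiveSolution l T (fun z => ρ z.1 z.2) (fun z => p z.1 z.2) (fun z => S z.1 z.2)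
      (fun z => u z.1 z.2 0) (fun z => u z.1 z.2 1) := by
  have hu : ∀ i : Fin 2,
      ContDiffOn ℝ 1 (fun z : ℝ × Plane => u z.1 z.2 i) (Icc 0 T ×ˢ univ) := fun i =>
    (EuclideanSpace.proj i : Plane →L[ℝ] ℝ).contDiff.comp_contDiffOn
      h.contDiff_velocity
  have dif : ∀ {q : ℝ × Plane → ℝ}, ContDiffOn ℝ 1 q (Icc 0 T ×ˢ univ) → ∀ t ∈ Ioo 0 T, ∀ x,
      DifferentiableAt ℝ q (t, x) := fun hq t ht x =>
    (contDiffAt_of_mem_Ioo hq ht x).differentiableAt one_ne_zero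
  have st : ∀ t ∈ Icc 0 T, ∀ x, p t x = Real.exp (S t x) * ρ t x ^ 2 := fun t ht x => by
    simpa using h.state t ht x
  have cont : ∀ t ∈ Ioo 0 T, ∀ x,
      fderiv ℝ (fun z : ℝ × Plane => ρ z.1 z.2) (t, x) (1, 0)
      + u t x 0 * fderiv ℝ (fun z : ℝ × Plane => ρ z.1 z.2) (t, x) (0, basisVec 0)
      + u t x 1 * fderiv ℝ (fun z : ℝ × Plane => ρ z.1 z.2) (t, x) (0, basisVec 1)
      + ρ t x * (fderiv ℝ (fun z : ℝ × Plane => u z.1 z.2 0) (t, x) (0, basisVec 0)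
        + fderiv ℝ (fun z : ℝ × Plane => u z.1 z.2 1) (t, x) (0, basisVec 1)) = 0 := by
    intro t ht x
    have hr := dif h.contDiff_density t ht x
    have h0 := dif (hu 0) t ht x
    have h1 := dif (hu 1) t ht x
    have e := h.continuity t ht x
    rw [Fin.sum_univ_two, dt_eq_fderiv hr,
      dx_eq_fderiv 0 (f := fun s y => ρ s y * u s y 0) (hr.mul h0),
      dx_eq_fderiv 1 (f := fun s y => ρ s y * u s y 1) (hr.mul h1),
      fderiv_fun_mul hr h0, fderiv_fun_mul hr h1] at e
    simp only [add_apply, smul_apply, smul_eq_mul] at e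
    linear_combination e
  have ent : ∀ t ∈ Ioo 0 T, ∀ x,
      fderiv ℝ (fun z : ℝ × Plane => S z.1 z.2) (t, x) (1, 0)
      + u t x 0 * fderiv ℝ (fun z : ℝ × Plane => S z.1 z.2) (t, x) (0, basisVec 0)
      + u t x 1 * fderiv ℝ (fun z : ℝ × Plane => S z.1 z.2) (t, x) (0, basisVec 1) = 0 := by
    intro t ht x
    have e := h.entropy t ht x
    have hS := dif h.contDiff_entropy t ht x
    rw [Fin.sum_univ_two, dt_eq_fderiv hS, dx_eq_fderiv 0 hS, dx_eq_fderiv 1 hS] at e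
    linear_combination e
  have mom : ∀ i : Fin 2, ∀ t ∈ Ioo 0 T, ∀ x,
      ρ t x * (fderiv ℝ (fun z : ℝ × Plane => u z.1 z.2 i) (t, x) (1, 0)
      + u t x 0 * fderiv ℝ (fun z : ℝ × Plane => u z.1 z.2 i) (t, x) (0, basisVec 0)
      + u t x 1 * fderiv ℝ (fun z : ℝ × Plane => u z.1 z.2 i) (t, x) (0, basisVec 1))
      + ρ t x * l * rot (u t x) i
      + fderiv ℝ (fun z : ℝ × Plane => p z.1 z.2) (t, x) (0, basisVec i) = 0 := by
    intro i t ht x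
    have e := h.momentum t ht x i
    have c := cont t ht x
    have hr := dif h.contDiff_density t ht x
    have hp := dif h.contDiff_pressure t ht x
    have h0 := dif (hu 0) t ht x
    have h1 := dif (hu 1) t ht x
    have hi := dif (hu i) t ht x
    rw [Fin.sum_univ_two, dt_eq_fderiv (f := fun s y => ρ s y * u s y i) (hr.mul hi),
      dx_eq_fderiv 0 (f := fun s y => ρ s y * u s y i * u s y 0) ((hr.mul hi).mul h0),
      dx_eq_fderiv 1 (f := fun s y => ρ s y * u s y i * u s y 1) ((hr.mul hi).mul h1),
      dx_eq_fderiv i hp,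
      fderiv_fun_mul (hr.fun_mul hi) h0, fderiv_fun_mul (hr.fun_mul hi) h1,
      fderiv_fun_mul hr hi] at e
    simp only [add_apply, smul_apply, smul_eq_mul] at e
    linear_combination e - u t x i * c
  have pres : ∀ t ∈ Ioo 0 T, ∀ x,
      fderiv ℝ (fun z : ℝ × Plane => p z.1 z.2) (t, x)
        = fderiv ℝ (fun z : ℝ × Plane => Real.exp (S z.1 z.2) * ρ z.1 z.2 ^ 2) (t, x) := by
    intro t ht x
    apply Filter.EventuallyEq.fderiv_eq
    filter_upwards [(isOpen_strip 0 T).mem_nhds ⟨ht, mem_univ x⟩] with z hz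
    exact st z.1 (Ioo_subset_Icc_self hz.1) z.2
  refine ⟨h.contDiff_density, h.contDiff_pressure, h.contDiff_entropy, hu 0, hu 1,
    h.density_pos, st, cont, ?_, ?_, ?_, ent⟩
  · intro t ht x
    have e := mom 0 t ht x
    simp only [rot, PiLp.toLp_apply, Matrix.cons_val_zero] at e
    linear_combination e
  · intro t ht x
    have e := mom 1 t ht x
    simp only [rot, PiLp.toLp_apply, Matrix.cons_val_one, Matrix.cons_val_fin_one] at e
    linear_combination e
  · intro t ht x
    have hr := dif h.contDiff_density t ht x
    have hS := dif h.contDiff_entropy t ht x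
    have c := cont t ht x
    have e := ent t ht x
    rw [pres t ht x, fderiv_fun_mul hS.exp (hr.fun_pow 2), fderiv_fun_pow 2 hr, fderiv_exp hS]
    simp only [add_apply, smul_apply, smul_eq_mul,
      st t (Ioo_subset_Icc_self ht) x]
    simp only [nsmul_eq_mul]
    push_cast
    linear_combination Real.exp (S t x) * ρ t x ^ 2 * e + 2 * Real.exp (S t x) * ρ t x * c

theorem hasDerivAt_max_zero_sq (s : ℝ) :
    HasDerivAt (fun s : ℝ => max s 0 ^ 2) (2 * max s 0) s := by
  rcases lt_trichotomy s 0 with h | rfl | h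
  · rw [max_eq_right h.le, mul_zero]
    refine (hasDerivAt_const s (0 : ℝ)).congr_of_eventuallyEq ?_
    filter_upwards [Iio_mem_nhds h] with y hy
    simp [max_eq_right (mem_Iio.1 hy).le]
  · rw [hasDerivAt_iff_isLittleO]
    refine Asymptotics.IsBigO.trans_isLittleO (g := fun y : ℝ => y ^ 2) ?_ ?_
    · refine Asymptotics.IsBigO.of_bound 1 (Eventually.of_forall fun y => ?_)
      rcases le_total y 0 with h | h
      · simp [max_eq_right h, sq_nonneg]
      · simp [max_eq_left h]
    · simpa using Asymptotics.isLittleO_pow_id (𝕜 := ℝ) one_lt_two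
  · rw [max_eq_left h.le]
    have h1 : HasDerivAt (fun s : ℝ => s ^ 2) (2 * s) s := by simpa using hasDerivAt_pow 2 s
    refine h1.congr_of_eventuallyEq ?_
    filter_upwards [Ioi_mem_nhds h] with y hy
    simp [max_eq_left (mem_Ioi.1 hy).le]

theorem contDiff_max_zero_sq : ContDiff ℝ 1 fun s : ℝ => max s 0 ^ 2 := by
  rw [contDiff_one_iff_deriv]
  refine ⟨fun s => (hasDerivAt_max_zero_sq s).differentiableAt, ?_⟩
  rw [funext fun s => (hasDerivAt_max_zero_sq s).deriv]
  fun_prop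

/-- The `i`-th space coordinate as a function on space-time. -/
def coord (i : Fin 2) (z : ℝ × Plane) : ℝ := z.2 i

@[fun_prop]
theorem contDiff_coord {n : WithTop ℕ∞} (i : Fin 2) : ContDiff ℝ n (coord i) :=
  ((EuclideanSpace.proj i : Plane →L[ℝ] ℝ).comp (ContinuousLinearMap.snd ℝ ℝ Plane)).contDiff

@[fun_prop]
theorem differentiableAt_coord (i : Fin 2) (z : ℝ × Plane) : DifferentiableAt ℝ (coord i) z :=
  (contDiff_coord (n := 1) i).contDiffAt.differentiableAt one_ne_zero

theorem fderiv_coord (i : Fin 2) (z w : ℝ × Plane) : fderiv ℝ (coord i) z w = w.2 i := by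
  have h : HasFDerivAt (coord i) ((EuclideanSpace.proj i : Plane →L[ℝ] ℝ).comp
      (ContinuousLinearMap.snd ℝ ℝ Plane)) z :=
    ((EuclideanSpace.proj i : Plane →L[ℝ] ℝ).comp
      (ContinuousLinearMap.snd ℝ ℝ Plane)).hasFDerivAt
  rw [h.fderiv]; rfl

@[simp] theorem basisVec_zero_zero : basisVec 0 0 = 1 := by simp [basisVec]

@[simp] theorem basisVec_zero_one : basisVec 0 1 = 0 := by simp [basisVec]

@[simp] theorem basisVec_one_zero : basisVec 1 0 = 0 := by simp [basisVec]

@[simp] theorem basisVec_one_one : basisVec 1 1 = 1 := by simp [basisVec]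

/-- Pointwise balance of the energy relative to a state of rest with pressure `P`. -/
theorem relativeEnergy_balance {l P : ℝ} {r p a b m : ℝ × Plane → ℝ} {z : ℝ × Plane}
    (hr : DifferentiableAt ℝ r z) (hp : DifferentiableAt ℝ p z) (ha : DifferentiableAt ℝ a z)
    (hb : DifferentiableAt ℝ b z) (hm : DifferentiableAt ℝ m z) (hp0 : p z ≠ 0)
    (e : fderiv ℝ r z (1, 0) + a z * fderiv ℝ r z (0, basisVec 0)
      + b z * fderiv ℝ r z (0, basisVec 1)
      + r z * (fderiv ℝ a z (0, basisVec 0) + fderiv ℝ b z (0, basisVec 1)) = 0)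
    (e0 : r z * (fderiv ℝ a z (1, 0) + a z * fderiv ℝ a z (0, basisVec 0)
      + b z * fderiv ℝ a z (0, basisVec 1)) - l * r z * b z
      + fderiv ℝ p z (0, basisVec 0) = 0)
    (e1 : r z * (fderiv ℝ b z (1, 0) + a z * fderiv ℝ b z (0, basisVec 0)
      + b z * fderiv ℝ b z (0, basisVec 1)) + l * r z * a z
      + fderiv ℝ p z (0, basisVec 1) = 0)
    (e2 : fderiv ℝ p z (1, 0) + a z * fderiv ℝ p z (0, basisVec 0)
      + b z * fderiv ℝ p z (0, basisVec 1)
      + 2 * p z * (fderiv ℝ a z (0, basisVec 0) + fderiv ℝ b z (0, basisVec 1)) = 0) :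
    fderiv ℝ (fun z => m z * (r z * (a z ^ 2 + b z ^ 2) / 2 + (p z - P) ^ 2 * (p z)⁻¹ / 4)) z (1, 0)
    + fderiv ℝ (fun z => m z * (r z * (a z ^ 2 + b z ^ 2) / 2 + (p z - P) ^ 2 * (p z)⁻¹ / 4
        + (p z - P)) * a z) z (0, basisVec 0)
    + fderiv ℝ (fun z => m z * (r z * (a z ^ 2 + b z ^ 2) / 2 + (p z - P) ^ 2 * (p z)⁻¹ / 4
        + (p z - P)) * b z) z (0, basisVec 1)
    = fderiv ℝ m z (1, 0) * (r z * (a z ^ 2 + b z ^ 2) / 2 + (p z - P) ^ 2 * (p z)⁻¹ / 4)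
    + (fderiv ℝ m z (0, basisVec 0) * a z + fderiv ℝ m z (0, basisVec 1) * b z)
      * (r z * (a z ^ 2 + b z ^ 2) / 2 + (p z - P) ^ 2 * (p z)⁻¹ / 4 + (p z - P))
    + m z * (3 / 4 * (p z - P) ^ 2 * (p z)⁻¹
      * (fderiv ℝ a z (0, basisVec 0) + fderiv ℝ b z (0, basisVec 1))) := by
  have hi : DifferentiableAt ℝ (fun z => (p z)⁻¹) z := hp.fun_inv hp0
  have hfi : fderiv ℝ (fun z => (p z)⁻¹) z = -((p z)⁻¹ ^ 2) • fderiv ℝ p z := by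
    have h := ((hasDerivAt_inv hp0).comp_hasFDerivAt z hp.hasFDerivAt).fderiv
    rw [inv_pow]
    exact h
  simp (disch := fun_prop) only [fderiv_fun_mul, fderiv_fun_add, fderiv_fun_sub, fderiv_fun_pow,
    fderiv_fun_const, div_eq_mul_inv, hfi, add_apply, smul_apply, sub_apply, smul_eq_mul,
    Pi.zero_apply, zero_apply, nsmul_eq_mul]
  have hpp := mul_inv_cancel₀ hp0
  generalize (p z)⁻¹ = q at *
  push_cast
  linear_combination m z * (a z ^ 2 + b z ^ 2) / 2 * e + m z * a z * e0 + m z * b z * e1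
    + m z * ((p z - P) * q / 2 - (p z - P) ^ 2 * q ^ 2 / 4) * e2
    - m z * (fderiv ℝ a z (0, basisVec 0) + fderiv ℝ b z (0, basisVec 1))
      * ((p z - P) - (p z - P) ^ 2 * q / 2) * hpp

theorem exists_bound_fderiv {T : ℝ} (hT : 0 < T) {q : ℝ × Plane → ℝ}
    (hq : ContDiffOn ℝ 1 q (Icc 0 T ×ˢ univ)) {k : Set Plane} (hk : IsCompact k)
    (v : ℝ × Plane) : ∃ C, ∀ t ∈ Ioo 0 T, ∀ x ∈ k, |fderiv ℝ q (t, x) v| ≤ C := by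
  have hc : ContinuousOn (fun z => fderivWithin ℝ q (Icc 0 T ×ˢ univ) z v) (Icc 0 T ×ˢ univ) :=
    (hq.continuousOn_fderivWithin ((uniqueDiffOn_Icc hT).prod uniqueDiffOn_univ) le_rfl).clm_apply
      continuousOn_const
  obtain ⟨C, hC⟩ := (isCompact_Icc.prod hk).exists_bound_of_continuousOn
    (hc.mono (prod_mono subset_rfl (subset_univ k)))
  refine ⟨C, fun t ht x hx => ?_⟩
  have h := hC (t, x) ⟨Ioo_subset_Icc_self ht, hx⟩
  rwa [fderivWithin_of_mem_nhds (mem_of_superset ((isOpen_strip 0 T).mem_nhds ⟨ht, mem_univ x⟩)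
    (prod_mono Ioo_subset_Icc_self subset_rfl))] at h

theorem mem_ball_iff_sq {c x : Plane} {R : ℝ} (hR : 0 ≤ R) :
    x ∈ ball c R ↔ (x 0 - c 0) ^ 2 + (x 1 - c 1) ^ 2 < R ^ 2 := by
  rw [mem_ball, dist_eq_norm, ← sq_lt_sq₀ (norm_nonneg _) hR, EuclideanSpace.real_norm_sq_eq,
    Fin.sum_univ_two]
  rfl

/-- On the lateral boundary of a cone of speed at least `|u| + c`, with `c` the sound speed, the
flux of the relative energy is outgoing. -/
theorem relativeEnergy_flux_nonpos {r a b p e σ R y₀ y₁ : ℝ} (hr : 0 < r) (hp : 0 < p)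
    (hσ : Real.sqrt (a ^ 2 + b ^ 2) + Real.sqrt (2 * p / r) ≤ σ) (hR : 0 ≤ R)
    (hy : y₀ ^ 2 + y₁ ^ 2 ≤ R ^ 2) :
    -(σ * R) * (r * (a ^ 2 + b ^ 2) / 2 + e ^ 2 * p⁻¹ / 4)
      - (y₀ * a + y₁ * b) * (r * (a ^ 2 + b ^ 2) / 2 + e ^ 2 * p⁻¹ / 4 + e) ≤ 0 := by
  set U := Real.sqrt (a ^ 2 + b ^ 2) with hU
  set c := Real.sqrt (2 * p / r) with hc
  have hU0 : 0 ≤ U := Real.sqrt_nonneg _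
  have hU2 : U ^ 2 = a ^ 2 + b ^ 2 := Real.sq_sqrt (by positivity)
  have hc0 : 0 < c := Real.sqrt_pos.2 (by positivity)
  have hc2 : c ^ 2 = 2 * p / r := Real.sq_sqrt (by positivity)
  have hp' : p = c ^ 2 * r / 2 := by rw [hc2]; field_simp
  set η := r * (a ^ 2 + b ^ 2) / 2 + e ^ 2 * p⁻¹ / 4 with hη
  have hη0 : 0 ≤ η := by positivity
  have hyu : |y₀ * a + y₁ * b| ≤ R * U := by
    apply abs_le_of_sq_le_sq _ (by positivity)
    have h1 : (y₀ ^ 2 + y₁ ^ 2) * (a ^ 2 + b ^ 2) ≤ R ^ 2 * U ^ 2 := by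
      rw [hU2]; gcongr
    nlinarith [sq_nonneg (y₀ * b - y₁ * a)]
  have hUe : U * |e| ≤ c * η := by
    have h1 : c * η = c * r * U ^ 2 / 2 + |e| ^ 2 / (2 * c * r) := by
      rw [hη, ← hU2, hp', sq_abs]; field_simp; ring
    have h2 : c * η - U * |e| = (c * r * U - |e|) ^ 2 / (2 * c * r) := by
      rw [h1]; field_simp; ring
    have h3 : 0 ≤ (c * r * U - |e|) ^ 2 / (2 * c * r) := by positivity
    linarith
  have h1 : -(y₀ * a + y₁ * b) * (η + e) ≤ R * U * (η + |e|) := by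
    refine (le_abs_self _).trans ?_
    rw [abs_mul, abs_neg]
    gcongr
    exact (abs_add_le _ _).trans (by rw [abs_of_nonneg hη0])
  have h2 : R * U * (η + |e|) ≤ R * (σ * η) := by
    have : U * (η + |e|) ≤ σ * η := by nlinarith
    calc R * U * (η + |e|) = R * (U * (η + |e|)) := by ring
      _ ≤ _ := by gcongr
  nlinarith

/-- The function `(ρ - σ t)² - |x - c|²`, positive exactly in a backward cone. -/
noncomputable def coneFun (c : Plane) (ρ σ : ℝ) (z : ℝ × Plane) : ℝ :=
  (ρ - σ * z.1) ^ 2 - (coord 0 z - c 0) ^ 2 - (coord 1 z - c 1) ^ 2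

theorem contDiff_coneFun (c : Plane) (ρ σ : ℝ) : ContDiff ℝ 1 (coneFun c ρ σ) := by
  unfold coneFun; fun_prop

theorem fderiv_coneFun (c : Plane) (ρ σ : ℝ) (z v : ℝ × Plane) :
    fderiv ℝ (coneFun c ρ σ) z v = -(2 * σ * (ρ - σ * z.1) * v.1)
      - 2 * (coord 0 z - c 0) * v.2 0 - 2 * (coord 1 z - c 1) * v.2 1 := by
  unfold coneFun
  have hz : fderiv ℝ (fun z : ℝ × Plane => z.1) z v = v.1 := by
    rw [fderiv_fst]; rfl
  simp (disch := fun_prop) only [fderiv_fun_mul, fderiv_fun_sub, fderiv_fun_pow,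
    fderiv_fun_const, add_apply, smul_apply, sub_apply, smul_eq_mul,
    Pi.zero_apply, zero_apply, nsmul_eq_mul, fderiv_coord, hz]
  push_cast
  ring

theorem fderiv_max_zero_sq {f : ℝ × Plane → ℝ} {z : ℝ × Plane} (hf : DifferentiableAt ℝ f z) :
    fderiv ℝ (fun z => max (f z) 0 ^ 2) z = (2 * max (f z) 0) • fderiv ℝ f z :=
  ((hasDerivAt_max_zero_sq (f z)).comp_hasFDerivAt z hf.hasFDerivAt).fderiv

namespace PrimitiveSolution

variable {l T : ℝ} {r p S a b : ℝ × Plane → ℝ}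

theorem p_pos (h : PrimitiveSolution l T r p S a b) {t : ℝ} (ht : t ∈ Icc 0 T) (x : Plane) :
    0 < p (t, x) := by
  rw [h.state t ht x]
  have := h.r_pos t ht x
  positivity

/-- A state of rest with constant pressure propagates into cones of speed at least `|u| + c`. -/
theorem rest_in_cone (h : PrimitiveSolution l T r p S a b) {P s s' ρ σ : ℝ} {c : Plane}
    (hs : 0 ≤ s) (hs' : s' ≤ T) (hss : s < s') (hσ0 : 0 ≤ σ) (hρ : 0 ≤ ρ - σ * s')
    (hinit : ∀ x ∈ ball c (ρ - σ * s), a (s, x) = 0 ∧ b (s, x) = 0 ∧ p (s, x) = P)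
    (hspeed : ∀ t ∈ Icc s s', ∀ x ∈ ball c (ρ - σ * t),
      Real.sqrt (a (t, x) ^ 2 + b (t, x) ^ 2) + Real.sqrt (2 * p (t, x) / r (t, x)) ≤ σ) :
    ∀ t ∈ Icc s s', ∀ x ∈ ball c (ρ - σ * t), a (t, x) = 0 ∧ b (t, x) = 0 ∧ p (t, x) = P := by
  have hsub : Icc s s' ⊆ Icc 0 T := Icc_subset_Icc hs hs'
  have hsub' : Ioo s s' ⊆ Ioo 0 T := Ioo_subset_Ioo hs hs'
  have hprod : Icc s s' ×ˢ (univ : Set Plane) ⊆ Icc 0 T ×ˢ univ := prod_mono hsub subset_rfl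
  have hr := h.smooth_r.mono hprod
  have hp := h.smooth_p.mono hprod
  have ha := h.smooth_a.mono hprod
  have hb := h.smooth_b.mono hprod
  set m : ℝ × Plane → ℝ := fun z => max (coneFun c ρ σ z) 0 ^ 2 with hm_def
  have hm : ContDiff ℝ 1 m := contDiff_max_zero_sq.comp (contDiff_coneFun c ρ σ)
  have hmd := hm.contDiffOn (s := Icc s s' ×ˢ univ)
  have hpi : ContDiffOn ℝ 1 (fun z => (p z)⁻¹) (Icc s s' ×ˢ univ) :=
    hp.inv fun z hz => (h.p_pos (hsub hz.1) z.2).ne'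
  set η : ℝ × Plane → ℝ :=
    fun z => r z * (a z ^ 2 + b z ^ 2) / 2 + (p z - P) ^ 2 * (p z)⁻¹ / 4 with hη_def
  have hη : ContDiffOn ℝ 1 η (Icc s s' ×ˢ univ) := by
    simp only [hη_def, div_eq_mul_inv]; fun_prop
  have hη0 : ∀ t ∈ Icc s s', ∀ x, 0 ≤ η (t, x) := fun t ht x => by
    have := h.r_pos t (hsub ht) x
    have := h.p_pos (hsub ht) x
    positivity
  have hradius : ∀ t ∈ Icc s s', 0 ≤ ρ - σ * t ∧ ρ - σ * t ≤ ρ - σ * s := fun t ht => by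
    have h1 := mul_le_mul_of_nonneg_left ht.1 hσ0
    have h2 := mul_le_mul_of_nonneg_left ht.2 hσ0
    exact ⟨by linarith, by linarith⟩
  have hcone : ∀ t ∈ Icc s s', ∀ x, 0 < coneFun c ρ σ (t, x) ↔ x ∈ ball c (ρ - σ * t) :=
    fun t ht x => by
      rw [mem_ball_iff_sq (hradius t ht).1]
      simp only [coneFun, coord]
      constructor <;> intro h <;> linarith
  have hm0 : ∀ t ∈ Icc s s', ∀ x, x ∉ ball c (ρ - σ * t) → m (t, x) = 0 := fun t ht x hx => by
    rw [← hcone t ht x, not_lt] at hx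
    simp [hm_def, max_eq_right hx]
  have hk := isCompact_closedBall c (ρ - σ * s)
  have hball : ∀ t ∈ Icc s s', ∀ x, x ∉ closedBall c (ρ - σ * s) → m (t, x) = 0 :=
    fun t ht x hx => hm0 t ht x fun hx' =>
      hx (ball_subset_closedBall (ball_subset_ball (hradius t ht).2 hx'))
  have hT : 0 < T := by linarith
  obtain ⟨A, hA⟩ := exists_bound_fderiv hT h.smooth_a hk (0, basisVec 0)
  obtain ⟨B, hB⟩ := exists_bound_fderiv hT h.smooth_b hk (0, basisVec 1)
  set q : ℝ × Plane → ℝ := fun z => m z * η z with hq_def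
  have hq : ContDiffOn ℝ 1 q (Icc s s' ×ˢ univ) := hmd.mul hη
  have hq0 : ∀ t ∈ Icc s s', ∀ x, 0 ≤ q (t, x) := fun t ht x =>
    mul_nonneg (sq_nonneg _) (hη0 t ht x)
  have hq_supp : ∀ t ∈ Icc s s', ∀ x ∉ closedBall c (ρ - σ * s), q (t, x) = 0 :=
    fun t ht x hx => by simp only [hq_def, hball t ht x hx, zero_mul]
  have hder := fun (t : ℝ) (ht : t ∈ Ioo s s') =>
    hasDerivAt_integral_of_balance hk hq hq_supp
      (f₀ := fun z => m z * (η z + (p z - P)) * a z) (by fun_prop)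
      (fun t ht x hx => by simp only [hball t ht x hx, zero_mul])
      (f₁ := fun z => m z * (η z + (p z - P)) * b z) (by fun_prop)
      (fun t ht x hx => by simp only [hball t ht x hx, zero_mul]) ht
      (fun x => by
        have dif : ∀ {q : ℝ × Plane → ℝ}, ContDiffOn ℝ 1 q (Icc s s' ×ˢ univ) →
            DifferentiableAt ℝ q (t, x) := fun hq =>
          (contDiffAt_of_mem_Ioo hq ht x).differentiableAt one_ne_zero
        exact relativeEnergy_balance (P := P) (dif hr) (dif hp) (dif ha) (dif hb) (dif hmd)
          (h.p_pos (hsub (Ioo_subset_Icc_self ht)) x).ne' (h.continuity t (hsub' ht) x)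
          (h.momentum₀ t (hsub' ht) x) (h.momentum₁ t (hsub' ht) x) (h.pressure t (hsub' ht) x))
  have hint : ∀ t ∈ Icc s s', Integrable fun x => q (t, x) := fun t ht =>
    (contDiff_slice_space hq ht).continuous.integrable_of_hasCompactSupport
      (HasCompactSupport.intro hk (hq_supp t ht))
  have hE := eq_zero_of_deriv_le_mul (C := 3 * (A + B)) (continuousOn_integral_slice hk hq hq_supp)
    (fun t ht => (hder t ht).2) (fun t ht => ?_)
    (fun t ht => integral_nonneg fun x => hq0 t ht x) ?_
  · intro t ht x hx
    have hc := (contDiff_slice_space hq ht).continuous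
    have hz : (fun x => q (t, x)) = 0 := by
      rw [← hc.ae_eq_iff_eq volume continuous_zero]
      exact (integral_eq_zero_iff_of_nonneg (fun x => hq0 t ht x) (hint t ht)).1 (hE t ht)
    have hz := congrFun hz x
    have hmpos : 0 < m (t, x) := by
      have := (hcone t ht x).2 hx
      simp only [hm_def, max_eq_left this.le]
      positivity
    have hηz : η (t, x) = 0 := (mul_eq_zero.1 hz).resolve_left hmpos.ne'
    have h1 := h.r_pos t (hsub ht) x
    have h2 := inv_pos.2 (h.p_pos (hsub ht) x)
    simp only [hη_def] at hηz
    have h3 : 0 ≤ r (t, x) * (a (t, x) ^ 2 + b (t, x) ^ 2) / 2 := by positivity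
    have h4 : 0 ≤ (p (t, x) - P) ^ 2 * (p (t, x))⁻¹ / 4 := by positivity
    have h5 : r (t, x) * (a (t, x) ^ 2 + b (t, x) ^ 2) = 0 := by linarith
    have h6 : (p (t, x) - P) ^ 2 * (p (t, x))⁻¹ = 0 := by linarith
    have h7 := (mul_eq_zero.1 h5).resolve_left h1.ne'
    have h8 := pow_eq_zero_iff (two_ne_zero) |>.1 ((mul_eq_zero.1 h6).resolve_right h2.ne')
    exact ⟨by nlinarith [sq_nonneg (b (t, x))], by nlinarith [sq_nonneg (a (t, x))], by linarith⟩
  · have ht' := Ioo_subset_Icc_self ht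
    rw [← integral_const_mul]
    refine integral_mono (hder t ht).1 ((hint t ht').const_mul _) fun x => ?_
    have hmf := fderiv_max_zero_sq (z := (t, x))
      ((contDiff_coneFun c ρ σ).differentiable one_ne_zero (t, x))
    simp only [hm_def, hmf, smul_apply, smul_eq_mul, fderiv_coneFun, hq_def]
    by_cases hx : x ∈ ball c (ρ - σ * t)
    · have hpos := (hcone t ht' x).2 hx
      have hx' := (mem_ball_iff_sq (hradius t ht').1).1 hx
      have hxk := ball_subset_closedBall (ball_subset_ball (hradius t ht').2 hx)
      have hAx := (abs_le.1 (hA t (hsub' ht) x hxk)).2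
      have hBx := (abs_le.1 (hB t (hsub' ht) x hxk)).2
      have hr1 := h.r_pos t (hsub ht') x
      have hp1 := h.p_pos (hsub ht') x
      have hflux := relativeEnergy_flux_nonpos (e := p (t, x) - P) hr1 hp1 (hspeed t ht' x hx)
        (hradius t ht').1 hx'.le
      rw [max_eq_left hpos.le]
      have hA0 : 0 ≤ A := (abs_nonneg _).trans (hA t (hsub' ht) x hxk)
      have hB0 : 0 ≤ B := (abs_nonneg _).trans (hB t (hsub' ht) x hxk)
      simp only [coord, hη_def, PiLp.zero_apply, basisVec_zero_zero, basisVec_zero_one,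
        basisVec_one_zero, basisVec_one_one]
      have hdiv : (p (t, x) - P) ^ 2 * (p (t, x))⁻¹ / 4
          * (fderiv ℝ a (t, x) (0, basisVec 0) + fderiv ℝ b (t, x) (0, basisVec 1))
          ≤ (r (t, x) * (a (t, x) ^ 2 + b (t, x) ^ 2) / 2 + (p (t, x) - P) ^ 2 * (p (t, x))⁻¹ / 4)
            * (A + B) := by
        have h1 : 0 ≤ r (t, x) * (a (t, x) ^ 2 + b (t, x) ^ 2) / 2 := by positivity
        have h2 : 0 ≤ (p (t, x) - P) ^ 2 * (p (t, x))⁻¹ / 4 := by positivity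
        exact (mul_le_mul_of_nonneg_left (add_le_add hAx hBx) h2).trans
          (mul_le_mul_of_nonneg_right (by linarith) (by linarith))
      have h1 := mul_le_mul_of_nonneg_left hflux hpos.le
      have h2 := mul_le_mul_of_nonneg_left hdiv (sq_nonneg (coneFun c ρ σ (t, x)))
      linarith
    · have hneg := hm0 t ht' x hx
      have : max (coneFun c ρ σ (t, x)) 0 = 0 := by
        rw [← hcone t ht' x, not_lt] at hx
        exact max_eq_right hx
      simp [this]
  · have hz : (fun x => q (s, x)) = 0 := by
      funext x
      by_cases hx : x ∈ ball c (ρ - σ * s)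
      · obtain ⟨h1, h2, h3⟩ := hinit x hx
        simp [hq_def, hη_def, h1, h2, h3]
      · simp [hq_def, hm0 s (left_mem_Icc.2 hss.le) x hx]
    rw [hz]; exact integral_zero _ _

end PrimitiveSolution

namespace PrimitiveSolution

variable {l T : ℝ} {r p S a b : ℝ × Plane → ℝ}

/-- Where the gas is at rest on a neighbourhood, the density does not change in time. -/
theorem density_const_of_rest (h : PrimitiveSolution l T r p S a b) {s s' ρ σ : ℝ} {c : Plane}
    (hs : 0 ≤ s) (hs' : s' ≤ T) (hσ0 : 0 ≤ σ)
    (hrest : ∀ t ∈ Icc s s', ∀ x ∈ ball c (ρ - σ * t), a (t, x) = 0 ∧ b (t, x) = 0)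
    {t : ℝ} (ht : t ∈ Icc s s') {x : Plane} (hx : x ∈ ball c (ρ - σ * t)) :
    r (t, x) = r (s, x) := by
  refine eq_left_of_hasDerivAt_zero (f := fun τ => r (τ, x)) (a := s) (b := t) ?_ ?_ t
    (right_mem_Icc.2 ht.1)
  · exact h.smooth_r.continuousOn.comp (by fun_prop) fun τ hτ =>
      ⟨⟨hs.trans hτ.1, hτ.2.trans (ht.2.trans hs')⟩, mem_univ x⟩
  · intro τ hτ
    have hτ' : τ ∈ Icc s s' := ⟨hτ.1.le, hτ.2.le.trans ht.2⟩
    have hτT : τ ∈ Ioo 0 T := ⟨hs.trans_lt hτ.1, hτ.2.trans_le (ht.2.trans hs')⟩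
    have hxτ : x ∈ ball c (ρ - σ * τ) := by
      refine ball_subset_ball ?_ hx
      have := mul_le_mul_of_nonneg_left hτ.2.le hσ0
      linarith
    have hz : ∀ {f : ℝ × Plane → ℝ}, ContDiffOn ℝ 1 f (Icc 0 T ×ˢ univ) →
        (∀ y ∈ ball c (ρ - σ * τ), f (τ, y) = 0) → ∀ v, fderiv ℝ f (τ, x) (0, v) = 0 := by
      intro f hf h0 v
      have h1 := hasFDerivAt_slice_space (hasFDerivAt_of_mem_Ioo hf hτT x)
      have h2 : HasFDerivAt (fun y => f (τ, y)) (0 : Plane →L[ℝ] ℝ) x :=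
        (hasFDerivAt_const (0 : ℝ) x).congr_of_eventuallyEq (by
          filter_upwards [isOpen_ball.mem_nhds hxτ] with y hy
          exact h0 y hy)
      simpa using congrArg (fun L => L v) (h1.unique h2)
    have h1 := h.continuity τ hτT x
    rw [hz h.smooth_a (fun y hy => (hrest τ hτ' y hy).1),
      hz h.smooth_b (fun y hy => (hrest τ hτ' y hy).2), (hrest τ hτ' x hxτ).1,
      (hrest τ hτ' x hxτ).2] at h1
    have h2 := hasDerivAt_slice_time (hasFDerivAt_of_mem_Ioo h.smooth_r hτT x)
    have h3 : fderiv ℝ r (τ, x) (1, 0) = 0 := by linarith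
    rwa [h3] at h2

/-- The constant state propagates into backward cones of any speed above its sound speed. -/
theorem const_in_cone (h : PrimitiveSolution l T r p S a b) {P D t₀ ρ σ : ℝ} {c : Plane}
    (ht₀ : 0 ≤ t₀) (ht₀T : t₀ ≤ T) (hσ : Real.sqrt (2 * P / D) < σ) (hρ : 0 ≤ ρ - σ * t₀)
    (hinit : ∀ x ∈ ball c ρ, (a (0, x), b (0, x), p (0, x), r (0, x)) = (0, 0, P, D)) :
    ∀ x ∈ ball c (ρ - σ * t₀), (a (t₀, x), b (t₀, x), p (t₀, x), r (t₀, x)) = (0, 0, P, D) := by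
  have hσ0 : 0 ≤ σ := (Real.sqrt_nonneg _).trans hσ.le
  set W : ℝ × Plane → ℝ × ℝ × ℝ × ℝ := fun z => (a z, b z, p z, r z) with hW
  have hWc : ContinuousOn W (Icc 0 T ×ˢ univ) :=
    h.smooth_a.continuousOn.prodMk (h.smooth_b.continuousOn.prodMk
      (h.smooth_p.continuousOn.prodMk h.smooth_r.continuousOn))
  set V : ℝ × Plane → ℝ :=
    fun z => Real.sqrt (a z ^ 2 + b z ^ 2) + Real.sqrt (2 * p z / r z) with hV
  have hVc : ContinuousOn V (Icc 0 T ×ˢ univ) := by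
    have h1 := h.smooth_a.continuousOn
    have h2 := h.smooth_b.continuousOn
    have h3 := h.smooth_p.continuousOn
    have h4 := h.smooth_r.continuousOn
    refine ContinuousOn.add (Real.continuous_sqrt.comp_continuousOn (by fun_prop))
      (Real.continuous_sqrt.comp_continuousOn (ContinuousOn.div (by fun_prop) h4 ?_))
    exact fun z hz => (h.r_pos z.1 hz.1 z.2).ne'
  suffices hmain : Icc 0 t₀ ⊆ {s | ∀ x ∈ ball c (ρ - σ * s), W (s, x) = (0, 0, P, D)} from
    hmain (right_mem_Icc.2 ht₀)
  apply IsClosed.Icc_subset_of_forall_exists_gt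
  · have he : {s | ∀ x ∈ ball c (ρ - σ * s), W (s, x) = (0, 0, P, D)} ∩ Icc 0 t₀
        = ⋂ x : Plane, (Icc 0 t₀ ∩ {s | ρ - σ * s ≤ dist x c}) ∪
            (Icc 0 t₀ ∩ (fun s => W (s, x)) ⁻¹' {(0, 0, P, D)}) := by
      ext s
      simp only [mem_inter_iff, mem_ofPred_eq, mem_iInter, mem_union, mem_preimage,
        mem_singleton_iff, mem_ball]
      constructor
      · intro hs x
        by_cases hx : dist x c < ρ - σ * s
        · exact Or.inr ⟨hs.2, hs.1 x hx⟩
        · exact Or.inl ⟨hs.2, not_lt.1 hx⟩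
      · intro hs
        refine ⟨fun x hx => ?_, (hs 0).elim And.left And.left⟩
        exact (hs x).elim (fun h' => absurd hx (not_lt.2 h'.2)) And.right
    rw [he]
    refine isClosed_iInter fun x => IsClosed.union ?_ ?_
    · exact isClosed_Icc.inter (isClosed_le (by fun_prop) (by fun_prop))
    · refine ContinuousOn.preimage_isClosed_of_isClosed ?_ isClosed_Icc isClosed_singleton
      exact hWc.comp (by fun_prop) fun s hs => ⟨⟨hs.1, hs.2.trans ht₀T⟩, mem_univ x⟩
  · intro x hx
    exact hinit x (by simpa using hx)
  · rintro s ⟨hsW, hs0, hst⟩ y (hy : s < y)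
    have hsT : s ∈ Icc 0 T := ⟨hs0, hst.le.trans ht₀T⟩
    have hσle : σ * s ≤ σ * t₀ := mul_le_mul_of_nonneg_left hst.le hσ0
    have hσpos : 0 < σ := (Real.sqrt_nonneg _).trans_lt hσ
    have hrad : 0 < ρ - σ * s := by
      have := mul_lt_mul_of_pos_left hst hσpos
      linarith
    have hcl : ∀ x ∈ closedBall c (ρ - σ * s), W (s, x) = (0, 0, P, D) := by
      rw [← closure_ball c hrad.ne']
      have hc : Continuous fun x => W (s, x) := by
        rw [← continuousOn_univ]
        exact hWc.comp (by fun_prop) fun x _ => ⟨hsT, mem_univ x⟩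
      exact Set.EqOn.closure (fun x hx => hsW x hx) hc continuous_const
    have htube : ∀ᶠ t in 𝓝 s, ∀ x ∈ closedBall c (ρ - σ * s), t ∈ Icc 0 T → V (t, x) < σ := by
      refine (isCompact_closedBall c _).eventually_forall_of_forall_eventually fun x hx => ?_
      have hVx : V (s, x) < σ := by
        have := hcl x hx
        simp only [hW, Prod.mk.injEq] at this
        simp only [hV, this]
        simpa using hσ
      have := (hVc (s, x) ⟨hsT, mem_univ x⟩).eventually_lt_const hVx
      rw [eventually_nhdsWithin_iff] at this
      exact this.mono fun z hz hzT => hz ⟨hzT, mem_univ _⟩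
    obtain ⟨ε, hε, hball⟩ := Metric.eventually_nhds_iff.1 htube
    set s' := min (s + ε / 2) (min y t₀) with hs'
    have hss' : s < s' := lt_min (by linarith) (lt_min hy hst)
    have hs't : s' ≤ t₀ := (min_le_right _ _).trans (min_le_right _ _)
    have hs'T := hs't.trans ht₀T
    refine ⟨s', fun x hx => ?_, hss', (min_le_right _ _).trans (min_le_left _ _)⟩
    have hrest := h.rest_in_cone (P := P) (c := c) (ρ := ρ) hs0 hs'T hss' hσ0 (by
        have := mul_le_mul_of_nonneg_left hs't hσ0
        linarith) (fun x hx => by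
          have := hsW x hx
          simp only [hW, Prod.mk.injEq] at this
          exact ⟨this.1, this.2.1, this.2.2.1⟩) (fun t ht x hx => by
          refine le_of_lt (hball (y := t) ?_ x ?_ ⟨hs0.trans ht.1, ht.2.trans hs'T⟩)
          · have : t ≤ s + ε / 2 := ht.2.trans (min_le_left _ _)
            rw [Real.dist_eq, abs_lt]
            constructor <;> linarith [ht.1]
          · have := mul_le_mul_of_nonneg_left ht.1 hσ0
            exact ball_subset_closedBall (ball_subset_ball (by linarith) hx))
    have hmem := right_mem_Icc.2 hss'.le
    have hd := h.density_const_of_rest hs0 hs'T hσ0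
      (fun t ht x hx => ⟨(hrest t ht x hx).1, (hrest t ht x hx).2.1⟩) hmem hx
    have hx' : x ∈ ball c (ρ - σ * s) := by
      refine ball_subset_ball ?_ hx
      have := mul_le_mul_of_nonneg_left hss'.le hσ0
      linarith
    have hD := hsW x hx'
    simp only [hW, Prod.mk.injEq] at hD ⊢
    obtain ⟨h1, h2, h3⟩ := hrest s' hmem x hx
    exact ⟨h1, h2, h3, hd.trans hD.2.2.2⟩

/-- Finite speed of propagation: a state which is constant outside the ball of radius `R` at time
`0` stays so outside the ball of radius `R + σ t`, with `σ` the sound speed of that state. -/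
theorem const_outside (h : PrimitiveSolution l T r p S a b) {P D R : ℝ} (hR : 0 < R)
    (hinit : ∀ x ∉ ball (0 : Plane) R, (a (0, x), b (0, x), p (0, x), r (0, x)) = (0, 0, P, D))
    {t : ℝ} (ht : t ∈ Icc 0 T) {x : Plane} (hx : x ∉ ball 0 (R + Real.sqrt (2 * P / D) * t)) :
    (a (t, x), b (t, x), p (t, x), r (t, x)) = (0, 0, P, D) := by
  set σ := Real.sqrt (2 * P / D) with hσ
  have hσ0 : 0 ≤ σ := Real.sqrt_nonneg _
  have hstrict : ∀ y : Plane, R + σ * t < ‖y‖ →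
      (a (t, y), b (t, y), p (t, y), r (t, y)) = (0, 0, P, D) := by
    intro y hy
    obtain ⟨σ', h1, h2⟩ : ∃ σ', σ < σ' ∧ R + σ' * t < ‖y‖ := by
      have hc : ContinuousAt (fun s => R + s * t) σ := by fun_prop
      have h3 := (hc.eventually_lt_const hy).filter_mono (nhdsWithin_le_nhds (s := Ioi σ))
      obtain ⟨σ', h4, h5⟩ := (h3.and (self_mem_nhdsWithin (s := Ioi σ))).exists
      exact ⟨σ', h5, h4⟩
    refine h.const_in_cone (c := y) (ρ := ‖y‖ - R) ht.1 ht.2 h1 (by linarith) (fun x hx => ?_) y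
      (mem_ball_self (by linarith))
    apply hinit
    rw [mem_ball, dist_eq_norm] at hx
    rw [mem_ball_zero_iff, not_lt]
    have := norm_sub_norm_le y x
    rw [norm_sub_rev] at this
    linarith
  rw [mem_ball_zero_iff, not_lt] at hx
  have hpos : 0 < ‖x‖ := by
    have := mul_nonneg hσ0 ht.1
    linarith
  have hcont : Continuous fun y => (a (t, y), b (t, y), p (t, y), r (t, y)) :=
    (contDiff_slice_space h.smooth_a ht).continuous.prodMk
      ((contDiff_slice_space h.smooth_b ht).continuous.prodMk
        ((contDiff_slice_space h.smooth_p ht).continuous.prodMk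
          (contDiff_slice_space h.smooth_r ht).continuous))
  have hlim : Tendsto (fun s : ℝ => (a (t, s • x), b (t, s • x), p (t, s • x), r (t, s • x)))
      (𝓝[>] 1) (𝓝 (a (t, x), b (t, x), p (t, x), r (t, x))) := by
    have h1 : Continuous fun s : ℝ => s • x := by fun_prop
    have h2 := ((hcont.comp h1).tendsto 1).mono_left (nhdsWithin_le_nhds (s := Ioi 1))
    simpa [Function.comp_def] using h2
  refine tendsto_nhds_unique hlim ((tendsto_const_nhds).congr' ?_)
  filter_upwards [self_mem_nhdsWithin] with s (hs : 1 < s)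
  refine (hstrict _ ?_).symm
  rw [norm_smul, Real.norm_of_nonneg (by linarith)]
  nlinarith

end PrimitiveSolution

namespace PrimitiveSolution

variable {l T P D t : ℝ} {r p S a b : ℝ × Plane → ℝ} {k : Set Plane}

theorem differentiableAt (h : PrimitiveSolution l T r p S a b) (ht : t ∈ Ioo 0 T) (x : Plane) :
    DifferentiableAt ℝ r (t, x) ∧ DifferentiableAt ℝ p (t, x) ∧ DifferentiableAt ℝ a (t, x) ∧
      DifferentiableAt ℝ b (t, x) :=
  ⟨(contDiffAt_of_mem_Ioo h.smooth_r ht x).differentiableAt one_ne_zero,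
    (contDiffAt_of_mem_Ioo h.smooth_p ht x).differentiableAt one_ne_zero,
    (contDiffAt_of_mem_Ioo h.smooth_a ht x).differentiableAt one_ne_zero,
    (contDiffAt_of_mem_Ioo h.smooth_b ht x).differentiableAt one_ne_zero⟩

theorem massExcess_balance (h : PrimitiveSolution l T r p S a b) (hk : IsCompact k)
    (hout : ∀ t ∈ Icc 0 T, ∀ x ∉ k, (a (t, x), b (t, x), p (t, x), r (t, x)) = (0, 0, P, D)) :
    ContinuousOn (fun t => ∫ x, (r (t, x) - D)) (Icc 0 T) ∧
      ∀ t ∈ Ioo 0 T, HasDerivAt (fun t => ∫ x, (r (t, x) - D)) 0 t := by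
  have sr := h.smooth_r; have sa := h.smooth_a; have sb := h.smooth_b
  simp only [Prod.mk.injEq] at hout
  have sq : ContDiffOn ℝ 1 (fun z => r z - D) (Icc 0 T ×ˢ univ) := by fun_prop
  refine ⟨continuousOn_integral_slice hk sq fun t ht x hx => by simp [hout t ht x hx], ?_⟩
  intro t ht
  have key := (hasDerivAt_integral_of_balance hk sq (fun t ht x hx => by simp [hout t ht x hx])
    (f₀ := fun z => r z * a z) (by fun_prop) (fun t ht x hx => by simp [hout t ht x hx])
    (f₁ := fun z => r z * b z) (by fun_prop) (fun t ht x hx => by simp [hout t ht x hx])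
    ht (g := fun _ => 0) fun x => ?_).2
  · simpa using key
  · obtain ⟨dr, dp, da, db⟩ := h.differentiableAt ht x
    simp (disch := fun_prop) only [fderiv_fun_mul, fderiv_fun_sub, fderiv_fun_const, add_apply,
      smul_apply, sub_apply, smul_eq_mul, Pi.zero_apply, zero_apply]
    linear_combination h.continuity t ht x

theorem firstMoment_balance (h : PrimitiveSolution l T r p S a b) (hk : IsCompact k)
    (hout : ∀ t ∈ Icc 0 T, ∀ x ∉ k, (a (t, x), b (t, x), p (t, x), r (t, x)) = (0, 0, P, D))
    (i : Fin 2) :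
    ContinuousOn (fun t => ∫ x, (r (t, x) - D) * coord i (t, x)) (Icc 0 T) ∧
      ∀ t ∈ Ioo 0 T, HasDerivAt (fun t => ∫ x, (r (t, x) - D) * coord i (t, x))
        (∫ x, r (t, x) * (basisVec 0 i * a (t, x) + basisVec 1 i * b (t, x))) t := by
  have sr := h.smooth_r; have sa := h.smooth_a; have sb := h.smooth_b
  simp only [Prod.mk.injEq] at hout
  have sq : ContDiffOn ℝ 1 (fun z => (r z - D) * coord i z) (Icc 0 T ×ˢ univ) := by fun_prop
  refine ⟨continuousOn_integral_slice hk sq fun t ht x hx => by simp [hout t ht x hx], ?_⟩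
  intro t ht
  refine (hasDerivAt_integral_of_balance hk sq (fun t ht x hx => by simp [hout t ht x hx])
    (f₀ := fun z => r z * a z * coord i z) (by fun_prop)
    (fun t ht x hx => by simp [hout t ht x hx])
    (f₁ := fun z => r z * b z * coord i z) (by fun_prop)
    (fun t ht x hx => by simp [hout t ht x hx]) ht fun x => ?_).2
  obtain ⟨dr, dp, da, db⟩ := h.differentiableAt ht x
  simp (disch := fun_prop) only [fderiv_fun_mul, fderiv_fun_sub, fderiv_fun_const, add_apply,
    smul_apply, sub_apply, smul_eq_mul, Pi.zero_apply, zero_apply, fderiv_coord, PiLp.zero_apply]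
  linear_combination coord i (t, x) * h.continuity t ht x

theorem momentum_balance₀ (h : PrimitiveSolution l T r p S a b) (hk : IsCompact k)
    (hout : ∀ t ∈ Icc 0 T, ∀ x ∉ k, (a (t, x), b (t, x), p (t, x), r (t, x)) = (0, 0, P, D)) :
    ContinuousOn (fun t => ∫ x, r (t, x) * a (t, x)) (Icc 0 T) ∧
      ∀ t ∈ Ioo 0 T, HasDerivAt (fun t => ∫ x, r (t, x) * a (t, x))
        (l * ∫ x, r (t, x) * b (t, x)) t := by
  have sr := h.smooth_r; have sa := h.smooth_a; have sb := h.smooth_b; have sp := h.smooth_p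
  simp only [Prod.mk.injEq] at hout
  have sq : ContDiffOn ℝ 1 (fun z => r z * a z) (Icc 0 T ×ˢ univ) := by fun_prop
  refine ⟨continuousOn_integral_slice hk sq fun t ht x hx => by simp [hout t ht x hx], ?_⟩
  intro t ht
  rw [← integral_const_mul]
  refine (hasDerivAt_integral_of_balance hk sq (fun t ht x hx => by simp [hout t ht x hx])
    (f₀ := fun z => r z * a z * a z + (p z - P)) (by fun_prop)
    (fun t ht x hx => by simp [hout t ht x hx])
    (f₁ := fun z => r z * a z * b z) (by fun_prop)
    (fun t ht x hx => by simp [hout t ht x hx]) ht fun x => ?_).2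
  obtain ⟨dr, dp, da, db⟩ := h.differentiableAt ht x
  simp (disch := fun_prop) only [fderiv_fun_mul, fderiv_fun_add, fderiv_fun_sub, fderiv_fun_const,
    add_apply, smul_apply, sub_apply, smul_eq_mul, Pi.zero_apply, zero_apply]
  linear_combination a (t, x) * h.continuity t ht x + h.momentum₀ t ht x

theorem momentum_balance₁ (h : PrimitiveSolution l T r p S a b) (hk : IsCompact k)
    (hout : ∀ t ∈ Icc 0 T, ∀ x ∉ k, (a (t, x), b (t, x), p (t, x), r (t, x)) = (0, 0, P, D)) :
    ContinuousOn (fun t => ∫ x, r (t, x) * b (t, x)) (Icc 0 T) ∧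
      ∀ t ∈ Ioo 0 T, HasDerivAt (fun t => ∫ x, r (t, x) * b (t, x))
        (-l * ∫ x, r (t, x) * a (t, x)) t := by
  have sr := h.smooth_r; have sa := h.smooth_a; have sb := h.smooth_b; have sp := h.smooth_p
  simp only [Prod.mk.injEq] at hout
  have sq : ContDiffOn ℝ 1 (fun z => r z * b z) (Icc 0 T ×ˢ univ) := by fun_prop
  refine ⟨continuousOn_integral_slice hk sq fun t ht x hx => by simp [hout t ht x hx], ?_⟩
  intro t ht
  rw [← integral_const_mul]
  refine (hasDerivAt_integral_of_balance hk sq (fun t ht x hx => by simp [hout t ht x hx])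
    (f₀ := fun z => r z * a z * b z) (by fun_prop)
    (fun t ht x hx => by simp [hout t ht x hx])
    (f₁ := fun z => r z * b z * b z + (p z - P)) (by fun_prop)
    (fun t ht x hx => by simp [hout t ht x hx]) ht fun x => ?_).2
  obtain ⟨dr, dp, da, db⟩ := h.differentiableAt ht x
  simp (disch := fun_prop) only [fderiv_fun_mul, fderiv_fun_add, fderiv_fun_sub, fderiv_fun_const,
    add_apply, smul_apply, sub_apply, smul_eq_mul, Pi.zero_apply, zero_apply]
  linear_combination b (t, x) * h.continuity t ht x + h.momentum₁ t ht x

theorem secondMoment_balance (h : PrimitiveSolution l T r p S a b) (hk : IsCompact k)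
    (hout : ∀ t ∈ Icc 0 T, ∀ x ∉ k, (a (t, x), b (t, x), p (t, x), r (t, x)) = (0, 0, P, D)) :
    ContinuousOn (fun t => ∫ x, (r (t, x) - D) * (coord 0 (t, x) ^ 2 + coord 1 (t, x) ^ 2) / 2)
      (Icc 0 T) ∧
      ∀ t ∈ Ioo 0 T, HasDerivAt
        (fun t => ∫ x, (r (t, x) - D) * (coord 0 (t, x) ^ 2 + coord 1 (t, x) ^ 2) / 2)
        (∫ x, r (t, x) * (a (t, x) * coord 0 (t, x) + b (t, x) * coord 1 (t, x))) t := by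
  have sr := h.smooth_r; have sa := h.smooth_a; have sb := h.smooth_b
  simp only [Prod.mk.injEq] at hout
  have sq : ContDiffOn ℝ 1 (fun z => (r z - D) * (coord 0 z ^ 2 + coord 1 z ^ 2) / 2)
      (Icc 0 T ×ˢ univ) := by simp only [div_eq_mul_inv]; fun_prop
  refine ⟨continuousOn_integral_slice hk sq fun t ht x hx => by simp [hout t ht x hx], ?_⟩
  intro t ht
  refine (hasDerivAt_integral_of_balance hk sq (fun t ht x hx => by simp [hout t ht x hx])
    (f₀ := fun z => r z * a z * (coord 0 z ^ 2 + coord 1 z ^ 2) * 2⁻¹) (by fun_prop)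
    (fun t ht x hx => by simp [hout t ht x hx])
    (f₁ := fun z => r z * b z * (coord 0 z ^ 2 + coord 1 z ^ 2) * 2⁻¹) (by fun_prop)
    (fun t ht x hx => by simp [hout t ht x hx]) ht fun x => ?_).2
  obtain ⟨dr, dp, da, db⟩ := h.differentiableAt ht x
  simp (disch := fun_prop) only [div_eq_mul_inv, fderiv_fun_mul, fderiv_fun_add, fderiv_fun_sub,
    fderiv_fun_pow, fderiv_fun_const, add_apply, smul_apply, sub_apply, smul_eq_mul,
    Pi.zero_apply, zero_apply, fderiv_coord, PiLp.zero_apply, nsmul_eq_mul, basisVec_zero_zero,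
    basisVec_zero_one, basisVec_one_zero, basisVec_one_one]
  push_cast
  linear_combination (coord 0 (t, x) ^ 2 + coord 1 (t, x) ^ 2) / 2 * h.continuity t ht x

theorem energy_balance (h : PrimitiveSolution l T r p S a b) (hk : IsCompact k)
    (hout : ∀ t ∈ Icc 0 T, ∀ x ∉ k, (a (t, x), b (t, x), p (t, x), r (t, x)) = (0, 0, P, D)) :
    ContinuousOn (fun t => ∫ x, (r (t, x) * (a (t, x) ^ 2 + b (t, x) ^ 2) / 2 + (p (t, x) - P)))
      (Icc 0 T) ∧
      ∀ t ∈ Ioo 0 T, HasDerivAt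
        (fun t => ∫ x, (r (t, x) * (a (t, x) ^ 2 + b (t, x) ^ 2) / 2 + (p (t, x) - P))) 0 t := by
  have sr := h.smooth_r; have sa := h.smooth_a; have sb := h.smooth_b; have sp := h.smooth_p
  simp only [Prod.mk.injEq] at hout
  have sq : ContDiffOn ℝ 1 (fun z => r z * (a z ^ 2 + b z ^ 2) / 2 + (p z - P))
      (Icc 0 T ×ˢ univ) := by simp only [div_eq_mul_inv]; fun_prop
  refine ⟨continuousOn_integral_slice hk sq fun t ht x hx => by simp [hout t ht x hx], ?_⟩
  intro t ht
  have key := (hasDerivAt_integral_of_balance hk sq (fun t ht x hx => by simp [hout t ht x hx])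
    (f₀ := fun z => (r z * (a z ^ 2 + b z ^ 2) * 2⁻¹ + 2 * p z) * a z) (by fun_prop)
    (fun t ht x hx => by simp [hout t ht x hx])
    (f₁ := fun z => (r z * (a z ^ 2 + b z ^ 2) * 2⁻¹ + 2 * p z) * b z) (by fun_prop)
    (fun t ht x hx => by simp [hout t ht x hx]) ht (g := fun _ => 0) fun x => ?_).2
  · simpa using key
  obtain ⟨dr, dp, da, db⟩ := h.differentiableAt ht x
  simp (disch := fun_prop) only [div_eq_mul_inv, fderiv_fun_mul, fderiv_fun_add, fderiv_fun_sub,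
    fderiv_fun_pow, fderiv_fun_const, add_apply, smul_apply, sub_apply, smul_eq_mul,
    Pi.zero_apply, zero_apply, nsmul_eq_mul]
  push_cast
  linear_combination (a (t, x) ^ 2 + b (t, x) ^ 2) / 2 * h.continuity t ht x
    + a (t, x) * h.momentum₀ t ht x + b (t, x) * h.momentum₁ t ht x + h.pressure t ht x

theorem angularMomentum_balance (h : PrimitiveSolution l T r p S a b) (hk : IsCompact k)
    (hout : ∀ t ∈ Icc 0 T, ∀ x ∉ k, (a (t, x), b (t, x), p (t, x), r (t, x)) = (0, 0, P, D)) :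
    ContinuousOn (fun t => ∫ x, r (t, x) * (a (t, x) * coord 1 (t, x) - b (t, x) * coord 0 (t, x)))
      (Icc 0 T) ∧
      ∀ t ∈ Ioo 0 T, HasDerivAt
        (fun t => ∫ x, r (t, x) * (a (t, x) * coord 1 (t, x) - b (t, x) * coord 0 (t, x)))
        (l * ∫ x, r (t, x) * (a (t, x) * coord 0 (t, x) + b (t, x) * coord 1 (t, x))) t := by
  have sr := h.smooth_r; have sa := h.smooth_a; have sb := h.smooth_b; have sp := h.smooth_p
  simp only [Prod.mk.injEq] at hout
  have sq : ContDiffOn ℝ 1 (fun z => r z * (a z * coord 1 z - b z * coord 0 z))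
      (Icc 0 T ×ˢ univ) := by fun_prop
  refine ⟨continuousOn_integral_slice hk sq fun t ht x hx => by simp [hout t ht x hx], ?_⟩
  intro t ht
  rw [← integral_const_mul]
  refine (hasDerivAt_integral_of_balance hk sq (fun t ht x hx => by simp [hout t ht x hx])
    (f₀ := fun z => r z * (a z * coord 1 z - b z * coord 0 z) * a z + (p z - P) * coord 1 z)
    (by fun_prop) (fun t ht x hx => by simp [hout t ht x hx])
    (f₁ := fun z => r z * (a z * coord 1 z - b z * coord 0 z) * b z - (p z - P) * coord 0 z)
    (by fun_prop) (fun t ht x hx => by simp [hout t ht x hx]) ht fun x => ?_).2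
  obtain ⟨dr, dp, da, db⟩ := h.differentiableAt ht x
  simp (disch := fun_prop) only [fderiv_fun_mul, fderiv_fun_add, fderiv_fun_sub,
    fderiv_fun_const, add_apply, smul_apply, sub_apply, smul_eq_mul,
    Pi.zero_apply, zero_apply, fderiv_coord, PiLp.zero_apply, basisVec_zero_zero,
    basisVec_zero_one, basisVec_one_zero, basisVec_one_one]
  linear_combination (a (t, x) * coord 1 (t, x) - b (t, x) * coord 0 (t, x)) * h.continuity t ht x
    + coord 1 (t, x) * h.momentum₀ t ht x - coord 0 (t, x) * h.momentum₁ t ht x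

theorem radialMomentum_balance (h : PrimitiveSolution l T r p S a b) (hk : IsCompact k)
    (hout : ∀ t ∈ Icc 0 T, ∀ x ∉ k, (a (t, x), b (t, x), p (t, x), r (t, x)) = (0, 0, P, D)) :
    ContinuousOn (fun t => ∫ x, r (t, x) * (a (t, x) * coord 0 (t, x) + b (t, x) * coord 1 (t, x)))
      (Icc 0 T) ∧
      ∀ t ∈ Ioo 0 T, HasDerivAt
        (fun t => ∫ x, r (t, x) * (a (t, x) * coord 0 (t, x) + b (t, x) * coord 1 (t, x)))
        (2 * (∫ x, (r (t, x) * (a (t, x) ^ 2 + b (t, x) ^ 2) / 2 + (p (t, x) - P)))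
          - l * ∫ x, r (t, x) * (a (t, x) * coord 1 (t, x) - b (t, x) * coord 0 (t, x))) t := by
  have sr := h.smooth_r; have sa := h.smooth_a; have sb := h.smooth_b; have sp := h.smooth_p
  simp only [Prod.mk.injEq] at hout
  have sq : ContDiffOn ℝ 1 (fun z => r z * (a z * coord 0 z + b z * coord 1 z))
      (Icc 0 T ×ˢ univ) := by fun_prop
  refine ⟨continuousOn_integral_slice hk sq fun t ht x hx => by simp [hout t ht x hx], ?_⟩
  intro t ht
  have ht' := Ioo_subset_Icc_self ht
  have hint : ∀ {q : ℝ × Plane → ℝ}, ContDiffOn ℝ 1 q (Icc 0 T ×ˢ univ) →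
      (∀ x ∉ k, q (t, x) = 0) → Integrable fun x => q (t, x) := fun hq h0 =>
    (contDiff_slice_space hq ht').continuous.integrable_of_hasCompactSupport
      (HasCompactSupport.intro hk h0)
  have i1 := hint (q := fun z => r z * (a z ^ 2 + b z ^ 2) / 2 + (p z - P))
    (by simp only [div_eq_mul_inv]; fun_prop) (fun x hx => by simp [hout t ht' x hx])
  have i2 := hint (q := fun z => r z * (a z * coord 1 z - b z * coord 0 z))
    (by fun_prop) (fun x hx => by simp [hout t ht' x hx])
  rw [← integral_const_mul, ← integral_const_mul,
    ← integral_sub (i1.const_mul 2) (i2.const_mul l)]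
  refine (hasDerivAt_integral_of_balance hk sq (fun t ht x hx => by simp [hout t ht x hx])
    (f₀ := fun z => r z * (a z * coord 0 z + b z * coord 1 z) * a z + (p z - P) * coord 0 z)
    (by fun_prop) (fun t ht x hx => by simp [hout t ht x hx])
    (f₁ := fun z => r z * (a z * coord 0 z + b z * coord 1 z) * b z + (p z - P) * coord 1 z)
    (by fun_prop) (fun t ht x hx => by simp [hout t ht x hx]) ht fun x => ?_).2
  obtain ⟨dr, dp, da, db⟩ := h.differentiableAt ht x
  simp (disch := fun_prop) only [fderiv_fun_mul, fderiv_fun_add, fderiv_fun_sub,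
    fderiv_fun_const, add_apply, smul_apply, sub_apply, smul_eq_mul,
    Pi.zero_apply, zero_apply, fderiv_coord, PiLp.zero_apply, basisVec_zero_zero,
    basisVec_zero_one, basisVec_one_zero, basisVec_one_one]
  linear_combination (a (t, x) * coord 0 (t, x) + b (t, x) * coord 1 (t, x)) * h.continuity t ht x
    + coord 0 (t, x) * h.momentum₀ t ht x + coord 1 (t, x) * h.momentum₁ t ht x

/-- The minimum principle for the entropy. -/
theorem entropy_ge (h : PrimitiveSolution l T r p S a b) (hk : IsCompact k) {κ : ℝ}
    (hout : ∀ t ∈ Icc 0 T, ∀ x ∉ k, κ ≤ S (t, x)) (hinit : ∀ x, κ ≤ S (0, x)) :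
    ∀ t ∈ Icc 0 T, ∀ x, κ ≤ S (t, x) := by
  have sr := h.smooth_r; have sa := h.smooth_a; have sb := h.smooth_b; have sS := h.smooth_S
  set m : ℝ × Plane → ℝ := fun z => max (κ - S z) 0 ^ 2 with hm
  have sm : ContDiffOn ℝ 1 m (Icc 0 T ×ˢ univ) :=
    contDiff_max_zero_sq.comp_contDiffOn (contDiffOn_const.sub sS)
  have hm0 : ∀ z, κ ≤ S z → m z = 0 := fun z hz => by
    simp [hm, max_eq_right (sub_nonpos.2 hz)]
  have sq : ContDiffOn ℝ 1 (fun z => r z * m z) (Icc 0 T ×ˢ univ) := by fun_prop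
  have hsupp : ∀ t ∈ Icc 0 T, ∀ x ∉ k, m (t, x) = 0 := fun t ht x hx => hm0 _ (hout t ht x hx)
  have hcont := continuousOn_integral_slice hk sq fun t ht x hx => by simp [hsupp t ht x hx]
  have hder : ∀ t ∈ Ioo 0 T, HasDerivAt (fun t => ∫ x, r (t, x) * m (t, x)) 0 t := by
    intro t ht
    have key := (hasDerivAt_integral_of_balance hk sq
      (fun t ht x hx => by simp [hsupp t ht x hx])
      (f₀ := fun z => r z * a z * m z) (by fun_prop) (fun t ht x hx => by simp [hsupp t ht x hx])
      (f₁ := fun z => r z * b z * m z) (by fun_prop) (fun t ht x hx => by simp [hsupp t ht x hx])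
      ht (g := fun _ => 0) fun x => ?_).2
    · simpa using key
    obtain ⟨dr, dp, da, db⟩ := h.differentiableAt ht x
    have dS := (contDiffAt_of_mem_Ioo sS ht x).differentiableAt one_ne_zero
    have dm := (contDiffAt_of_mem_Ioo sm ht x).differentiableAt one_ne_zero
    have em : fderiv ℝ m (t, x) = -(2 * max (κ - S (t, x)) 0) • fderiv ℝ S (t, x) := by
      rw [hm, fderiv_max_zero_sq (f := fun z => κ - S z) (dS.const_sub κ), fderiv_const_sub]
      exact ContinuousLinearMap.ext fun v => by simp
    simp (disch := fun_prop) only [fderiv_fun_mul, add_apply, smul_apply, smul_eq_mul, em]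
    linear_combination m (t, x) * h.continuity t ht x
      - r (t, x) * (2 * max (κ - S (t, x)) 0) * h.entropy t ht x
  intro t ht x
  have hzero : ∫ x, r (t, x) * m (t, x) = 0 := by
    rw [eq_left_of_hasDerivAt_zero hcont hder t ht]
    simp [hm0 _ (hinit _)]
  have hnn : ∀ x, 0 ≤ r (t, x) * m (t, x) := fun x =>
    mul_nonneg (h.r_pos t ht x).le (sq_nonneg _)
  have hc := (contDiff_slice_space sq ht).continuous
  have hi : Integrable fun x => r (t, x) * m (t, x) := hc.integrable_of_hasCompactSupport
    (HasCompactSupport.intro hk fun x hx => by rw [hsupp t ht x hx, mul_zero])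
  have hz : (fun x => r (t, x) * m (t, x)) = 0 := by
    rw [← hc.ae_eq_iff_eq volume continuous_zero]
    exact (integral_eq_zero_iff_of_nonneg hnn hi).1 hzero
  have hmz := (mul_eq_zero.1 (congrFun hz x)).resolve_left (h.r_pos t ht x).ne'
  have hmax := (pow_eq_zero_iff two_ne_zero).1 hmz
  linarith [le_max_left (κ - S (t, x)) 0]

end PrimitiveSolution

section Functionals

variable {f p : Plane → ℝ} {u : Plane → Plane} {R D P : ℝ}

theorem volume_real_ball (c : Plane) {R : ℝ} (hR : 0 ≤ R) :
    volume.real (ball c R) = Real.pi * R ^ 2 := by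
  rw [Measure.real, EuclideanSpace.volume_ball_fin_two, ENNReal.toReal_mul, ENNReal.toReal_pow,
    ENNReal.toReal_ofReal hR, ENNReal.toReal_ofReal Real.pi_pos.le, mul_comm]

theorem integral_ball_norm_sq (hR : 0 ≤ R) :
    ∫ x in ball (0 : Plane) R, ‖x‖ ^ 2 = Real.pi * R ^ 4 / 2 := by
  have h := integral_fun_norm_addHaar (volume : Measure Plane)
    (fun y : ℝ => (Iio R).indicator (fun y => y ^ 2) y)
  have h1 : ∀ x : Plane, (Iio R).indicator (fun y : ℝ => y ^ 2) ‖x‖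
      = (ball (0 : Plane) R).indicator (fun x => ‖x‖ ^ 2) x := fun x => by
    by_cases hx : ‖x‖ < R
    · rw [indicator_of_mem (mem_Iio.2 hx), indicator_of_mem (mem_ball_zero_iff.2 hx)]
    · rw [indicator_of_notMem (by simpa using hx), indicator_of_notMem (by simpa using hx)]
  have h2 : ∫ y in Ioi (0 : ℝ), y ^ (Module.finrank ℝ Plane - 1) •
      (Iio R).indicator (fun y => y ^ 2) y = ∫ y in (0 : ℝ)..R, y ^ 3 := by
    rw [intervalIntegral.integral_of_le hR, integral_Ioc_eq_integral_Ioo,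
      ← Ioi_inter_Iio, ← setIntegral_indicator measurableSet_Iio]
    congr 1 with y
    by_cases hy : y < R
    · rw [indicator_of_mem (mem_Iio.2 hy), indicator_of_mem (mem_Iio.2 hy)]
      simp; ring
    · rw [indicator_of_notMem (by simpa using hy), indicator_of_notMem (by simpa using hy)]
      simp
  rw [h2, integral_pow] at h
  simp only [h1] at h
  rw [integral_indicator measurableSet_ball] at h
  rw [h, volume_real_ball 0 zero_le_one]
  simp
  ring

theorem integral_ball_coord (R : ℝ) (i : Fin 2) : ∫ x in ball (0 : Plane) R, x i = 0 := by
  rw [← integral_indicator measurableSet_ball]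
  have h := integral_neg_eq_self ((ball (0 : Plane) R).indicator fun x => x i) volume
  have h1 : ∀ x : Plane, (ball (0 : Plane) R).indicator (fun x => x i) (-x)
      = -(ball (0 : Plane) R).indicator (fun x => x i) x := fun x => by
    by_cases hx : ‖x‖ < R
    · rw [indicator_of_mem (by simpa using hx), indicator_of_mem (by simpa using hx)]; simp
    · rw [indicator_of_notMem (by simpa using hx), indicator_of_notMem (by simpa using hx)]; simp
  simp only [h1, integral_neg] at h
  linarith

theorem integrableOn_ball {E : Type*} [NormedAddCommGroup E] {g : Plane → E} (hg : Continuous g)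
    (c : Plane) (R : ℝ) : IntegrableOn g (ball c R) :=
  (hg.continuousOn.integrableOn_compact (isCompact_closedBall c R)).mono_set ball_subset_closedBall

theorem continuous_coord_apply (i : Fin 2) : Continuous fun x : Plane => x i :=
  (EuclideanSpace.proj i : Plane →L[ℝ] ℝ).continuous

theorem norm_sq_eq_coord (x : Plane) : ‖x‖ ^ 2 = x 0 ^ 2 + x 1 ^ 2 := by
  rw [EuclideanSpace.real_norm_sq_eq, Fin.sum_univ_two]

theorem inner_eq_coord (x y : Plane) : inner ℝ x y = x 0 * y 0 + x 1 * y 1 := by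
  simp [PiLp.inner_apply, Fin.sum_univ_two, mul_comm]

theorem setIntegral_ball_eq_integral {g : Plane → ℝ} (h : ∀ x ∉ ball (0 : Plane) R, g x = 0) :
    ∫ x in ball (0 : Plane) R, g x = ∫ x, g x :=
  setIntegral_eq_integral_of_forall_compl_eq_zero h

theorem massExcess_eq (hfo : ∀ x ∉ ball (0 : Plane) R, f x = D) :
    massExcess D R f = ∫ x, (f x - D) :=
  setIntegral_ball_eq_integral fun x hx => by rw [hfo x hx, sub_self]

theorem setIntegral_density_eq (hf : Continuous f) (hR : 0 ≤ R)
    (hfo : ∀ x ∉ ball (0 : Plane) R, f x = D) :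
    ∫ x in ball (0 : Plane) R, f x = (∫ x, (f x - D)) + Real.pi * D * R ^ 2 := by
  rw [← massExcess_eq hfo, massExcess, integral_sub (integrableOn_ball hf 0 R)
    (integrableOn_ball continuous_const 0 R), setIntegral_const, volume_real_ball 0 hR, smul_eq_mul]
  ring

theorem secondMoment_eq (hf : Continuous f) (hR : 0 ≤ R)
    (hfo : ∀ x ∉ ball (0 : Plane) R, f x = D) :
    secondMoment R f = (∫ x, (f x - D) * (x 0 ^ 2 + x 1 ^ 2) / 2) + D * Real.pi * R ^ 4 / 4 := by
  rw [← setIntegral_ball_eq_integral (R := R) fun x hx => by simp [hfo x hx], secondMoment]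
  have h1 : ∫ x in ball (0 : Plane) R, (f x - D) * (x 0 ^ 2 + x 1 ^ 2) / 2
      = ∫ x in ball (0 : Plane) R, (1 / 2 * (‖x‖ ^ 2 * f x) - D / 2 * ‖x‖ ^ 2) := by
    congr 1 with x
    rw [norm_sq_eq_coord]
    ring
  rw [h1, integral_sub (integrableOn_ball (by fun_prop) 0 R) (integrableOn_ball (by fun_prop) 0 R),
    integral_const_mul, integral_const_mul, integral_ball_norm_sq hR]
  ring

theorem firstMoment_apply (hf : Continuous f) (i : Fin 2) :
    firstMoment R f i = ∫ x in ball (0 : Plane) R, f x * x i := by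
  have h := (EuclideanSpace.proj i : Plane →L[ℝ] ℝ).integral_comp_comm
    (integrableOn_ball (g := fun x : Plane => f x • x) (by fun_prop) 0 R)
  simpa [firstMoment] using h.symm

theorem firstMoment_eq (hf : Continuous f) (hfo : ∀ x ∉ ball (0 : Plane) R, f x = D) (i : Fin 2) :
    firstMoment R f i = ∫ x, (f x - D) * x i := by
  have hc := continuous_coord_apply i
  rw [firstMoment_apply hf, ← setIntegral_ball_eq_integral (R := R) fun x hx => by simp [hfo x hx]]
  simp only [sub_mul]
  rw [integral_sub (integrableOn_ball (by fun_prop) 0 R) (integrableOn_ball (by fun_prop) 0 R),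
    integral_const_mul, integral_ball_coord]
  simp

theorem totalMomentum_eq (hf : Continuous f) (hu : Continuous u)
    (huo : ∀ x ∉ ball (0 : Plane) R, u x = 0) (i : Fin 2) :
    totalMomentum R f u i = ∫ x, f x * u x i := by
  have h := (EuclideanSpace.proj i : Plane →L[ℝ] ℝ).integral_comp_comm
    (integrableOn_ball (g := fun x : Plane => f x • u x) (by fun_prop) 0 R)
  rw [← setIntegral_ball_eq_integral (R := R) fun x hx => by simp [huo x hx]]
  simpa [totalMomentum] using h.symm

theorem radialMomentum_eq (huo : ∀ x ∉ ball (0 : Plane) R, u x = 0) :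
    radialMomentum R f u = ∫ x, f x * (u x 0 * x 0 + u x 1 * x 1) := by
  rw [← setIntegral_ball_eq_integral (R := R) fun x hx => by simp [huo x hx]]
  simp only [radialMomentum, inner_eq_coord]

theorem angularMomentum_eq (huo : ∀ x ∉ ball (0 : Plane) R, u x = 0) :
    angularMomentum R f u = ∫ x, f x * (u x 0 * x 1 - u x 1 * x 0) := by
  rw [← setIntegral_ball_eq_integral (R := R) fun x hx => by simp [huo x hx]]
  simp [angularMomentum, inner_eq_coord, perp, sub_eq_add_neg]

theorem totalEnergy_eq (hf : Continuous f) (hp : Continuous p) (hu : Continuous u)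
    (hpo : ∀ x ∉ ball (0 : Plane) R, p x = P) (huo : ∀ x ∉ ball (0 : Plane) R, u x = 0) :
    totalEnergy 2 P R f p u = ∫ x, (f x * (u x 0 ^ 2 + u x 1 ^ 2) / 2 + (p x - P)) := by
  rw [← setIntegral_ball_eq_integral (R := R) fun x hx => by simp [huo x hx, hpo x hx]]
  have h1 : ∫ x in ball (0 : Plane) R, (f x * (u x 0 ^ 2 + u x 1 ^ 2) / 2 + (p x - P))
      = ∫ x in ball (0 : Plane) R, (1 / 2 * (f x * ‖u x‖ ^ 2) + (p x - P)) := by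
    congr 1 with x
    rw [norm_sq_eq_coord]
    ring
  rw [h1, integral_add (integrableOn_ball (by fun_prop) 0 R) (integrableOn_ball (by fun_prop) 0 R),
    integral_const_mul, totalEnergy, kineticEnergy]
  norm_num

end Functionals

theorem harmonic_eq_zero {l T : ℝ} {Y V : ℝ → ℝ} (hY : ContinuousOn Y (Icc 0 T))
    (hV : ContinuousOn V (Icc 0 T)) (hY' : ∀ t ∈ Ioo 0 T, HasDerivAt Y (V t) t)
    (hV' : ∀ t ∈ Ioo 0 T, HasDerivAt V (-l ^ 2 * Y t) t) (hY0 : Y 0 = 0) (hV0 : V 0 = 0) :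
    ∀ t ∈ Icc 0 T, Y t = 0 := by
  have hVz : ∀ t ∈ Icc 0 T, V t = 0 := fun t ht => by
    have h := eq_left_of_hasDerivAt_zero (f := fun t => V t ^ 2 + l ^ 2 * Y t ^ 2)
      (a := 0) (b := T) (by fun_prop) (fun t ht => by
        have h1 := ((hV' t ht).fun_pow 2).fun_add (((hY' t ht).fun_pow 2).const_mul (l ^ 2))
        refine h1.congr_deriv ?_
        push_cast
        ring) t ht
    simp only [hY0, hV0] at h
    nlinarith [sq_nonneg (V t), mul_nonneg (sq_nonneg l) (sq_nonneg (Y t))]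
  intro t ht
  rw [← hY0]
  exact eq_left_of_hasDerivAt_zero hY (fun t ht => by
    simpa [hVz t (Ioo_subset_Icc_self ht)] using hY' t ht) t ht

/-- The solution of `y'' + l² y = A` with `y(0) = y₀`, `y'(0) = v₀`. -/
noncomputable def forcedOscillation (l y₀ v₀ A t : ℝ) : ℝ :=
  if l = 0 then v₀ * t + y₀ + A / 2 * t ^ 2
  else v₀ / l * Real.sin (l * t) + (y₀ - A / l ^ 2) * Real.cos (l * t) + A / l ^ 2

/-- The derivative of `forcedOscillation`. -/
noncomputable def forcedOscillationDeriv (l y₀ v₀ A t : ℝ) : ℝ :=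
  if l = 0 then v₀ + A * t
  else v₀ * Real.cos (l * t) - (y₀ * l - A / l) * Real.sin (l * t)

theorem hasDerivAt_sin_mul (l t : ℝ) :
    HasDerivAt (fun t => Real.sin (l * t)) (l * Real.cos (l * t)) t := by
  have h := ((hasDerivAt_id t).const_mul l).sin
  simpa [mul_comm] using h

theorem hasDerivAt_cos_mul (l t : ℝ) :
    HasDerivAt (fun t => Real.cos (l * t)) (-(l * Real.sin (l * t))) t := by
  have h := ((hasDerivAt_id t).const_mul l).cos
  simpa [mul_comm] using h

theorem hasDerivAt_forcedOscillation (l y₀ v₀ A t : ℝ) :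
    HasDerivAt (forcedOscillation l y₀ v₀ A) (forcedOscillationDeriv l y₀ v₀ A t) t := by
  unfold forcedOscillation forcedOscillationDeriv
  by_cases hl : l = 0
  · simp only [if_pos hl]
    have h := (((hasDerivAt_id t).const_mul v₀).add_const y₀).fun_add
      ((hasDerivAt_pow 2 t).const_mul (A / 2))
    refine h.congr_deriv ?_
    push_cast
    ring
  · simp only [if_neg hl]
    have h := (((hasDerivAt_sin_mul l t).const_mul (v₀ / l)).fun_add
      ((hasDerivAt_cos_mul l t).const_mul (y₀ - A / l ^ 2))).add_const (A / l ^ 2)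
    refine h.congr_deriv ?_
    field_simp
    ring

theorem hasDerivAt_forcedOscillationDeriv (l y₀ v₀ A t : ℝ) :
    HasDerivAt (forcedOscillationDeriv l y₀ v₀ A) (A - l ^ 2 * forcedOscillation l y₀ v₀ A t) t := by
  unfold forcedOscillation forcedOscillationDeriv
  by_cases hl : l = 0
  · simp only [if_pos hl]
    have h := ((hasDerivAt_id t).const_mul A).const_add v₀
    refine h.congr_deriv ?_
    rw [hl]
    ring
  · simp only [if_neg hl]
    have h := ((hasDerivAt_cos_mul l t).const_mul v₀).fun_sub
      ((hasDerivAt_sin_mul l t).const_mul (y₀ * l - A / l))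
    refine h.congr_deriv ?_
    field_simp
    ring

theorem forcedOscillation_zero (l y₀ v₀ A : ℝ) : forcedOscillation l y₀ v₀ A 0 = y₀ := by
  unfold forcedOscillation
  split_ifs <;> simp

theorem forcedOscillationDeriv_zero (l y₀ v₀ A : ℝ) : forcedOscillationDeriv l y₀ v₀ A 0 = v₀ := by
  unfold forcedOscillationDeriv
  split_ifs <;> simp

theorem eq_forcedOscillation {l T A : ℝ} {Y V : ℝ → ℝ} (hY : ContinuousOn Y (Icc 0 T))
    (hV : ContinuousOn V (Icc 0 T)) (hY' : ∀ t ∈ Ioo 0 T, HasDerivAt Y (V t) t)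
    (hV' : ∀ t ∈ Ioo 0 T, HasDerivAt V (A - l ^ 2 * Y t) t) :
    ∀ t ∈ Icc 0 T, Y t = forcedOscillation l (Y 0) (V 0) A t := by
  intro t ht
  have h1 := fun t => hasDerivAt_forcedOscillation l (Y 0) (V 0) A t
  have h2 := fun t => hasDerivAt_forcedOscillationDeriv l (Y 0) (V 0) A t
  have c1 := (continuous_iff_continuousAt.2 fun t => (h1 t).continuousAt).continuousOn (s := Icc 0 T)
  have c2 := (continuous_iff_continuousAt.2 fun t => (h2 t).continuousAt).continuousOn (s := Icc 0 T)
  have h := harmonic_eq_zero (l := l) (hY.sub c1) (hV.sub c2)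
    (fun t ht => (hY' t ht).sub (h1 t)) (fun t ht => ?_)
    (by simp [forcedOscillation_zero]) (by simp [forcedOscillationDeriv_zero]) t ht
  · simp only [Pi.sub_apply] at h
    linarith
  · refine ((hV' t ht).sub (h2 t)).congr_deriv ?_
    simp only [Pi.sub_apply]
    ring

/-- The rotation equation `y₀' = l y₁`, `y₁' = -l y₀`. -/
theorem eq_rotation {l T : ℝ} {y₀ y₁ : ℝ → ℝ} (h0 : ContinuousOn y₀ (Icc 0 T))
    (h1 : ContinuousOn y₁ (Icc 0 T)) (h0' : ∀ t ∈ Ioo 0 T, HasDerivAt y₀ (l * y₁ t) t)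
    (h1' : ∀ t ∈ Ioo 0 T, HasDerivAt y₁ (-l * y₀ t) t) :
    ∀ t ∈ Icc 0 T, y₀ t = y₀ 0 * Real.cos (l * t) + y₁ 0 * Real.sin (l * t) ∧
      y₁ t = y₁ 0 * Real.cos (l * t) - y₀ 0 * Real.sin (l * t) := by
  intro t ht
  have h := eq_left_of_hasDerivAt_zero (a := 0) (b := T)
    (f := fun t => (y₀ t - (y₀ 0 * Real.cos (l * t) + y₁ 0 * Real.sin (l * t))) ^ 2
      + (y₁ t - (y₁ 0 * Real.cos (l * t) - y₀ 0 * Real.sin (l * t))) ^ 2) (by fun_prop)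
    (fun t ht => by
      have e0 := (h0' t ht).fun_sub (((hasDerivAt_cos_mul l t).const_mul (y₀ 0)).fun_add
        ((hasDerivAt_sin_mul l t).const_mul (y₁ 0)))
      have e1 := (h1' t ht).fun_sub (((hasDerivAt_cos_mul l t).const_mul (y₁ 0)).fun_sub
        ((hasDerivAt_sin_mul l t).const_mul (y₀ 0)))
      refine ((e0.fun_pow 2).fun_add (e1.fun_pow 2)).congr_deriv ?_
      push_cast
      ring) t ht
  simp only [mul_zero, Real.cos_zero, Real.sin_zero] at h
  constructor <;> nlinarith [
    sq_nonneg (y₀ t - (y₀ 0 * Real.cos (l * t) + y₁ 0 * Real.sin (l * t))),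
    sq_nonneg (y₁ t - (y₁ 0 * Real.cos (l * t) - y₀ 0 * Real.sin (l * t)))]

namespace CauchyData

variable (d : CauchyData) (l : ℝ)

theorem soundSpeed_pos : 0 < d.soundSpeed 2 := by
  have := d.ρbar_pos
  have := d.pbar_pos
  exact Real.sqrt_pos.2 (by positivity)

theorem radius_zero : d.radius 2 0 = d.R := by simp [radius]

theorem R_le_radius {t : ℝ} (ht : 0 ≤ t) : d.R ≤ d.radius 2 t :=
  le_add_of_nonneg_right (mul_nonneg d.soundSpeed_pos.le ht)

theorem radius_pos {t : ℝ} (ht : 0 ≤ t) : 0 < d.radius 2 t := d.R_pos.trans_le (d.R_le_radius ht)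

theorem G_eq (t : ℝ) : d.G l t = forcedOscillation l (secondMoment d.R d.ρ₀)
    (radialMomentum d.R d.ρ₀ d.u₀) (d.A₀ 2 l) t
      + d.ρbar * Real.pi * (d.radius 2 t ^ 4 - d.R ^ 4) / 4 := by
  unfold G forcedOscillation radius
  ring

theorem I_zero (t : ℝ) : d.I l t 0 = totalMomentum d.R d.ρ₀ d.u₀ 0 * Real.cos (l * t)
    + totalMomentum d.R d.ρ₀ d.u₀ 1 * Real.sin (l * t) := by simp [I]

theorem I_one (t : ℝ) : d.I l t 1 = totalMomentum d.R d.ρ₀ d.u₀ 1 * Real.cos (l * t)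
    - totalMomentum d.R d.ρ₀ d.u₀ 0 * Real.sin (l * t) := by simp [I]

theorem continuous_I : Continuous (d.I l) := by
  unfold I
  refine (PiLp.continuous_toLp 2 _).comp (continuous_pi fun i => ?_)
  fin_cases i
  · simp only [Fin.zero_eta, Matrix.cons_val_zero]; fun_prop
  · simp only [Fin.mk_one, Matrix.cons_val_one, Matrix.cons_val_fin_one]; fun_prop

theorem hasDerivAt_P (t : ℝ) : HasDerivAt (d.P l) (d.I l t) t := by
  have h := intervalIntegral.integral_hasDerivAt_right ((d.continuous_I l).intervalIntegrable 0 t)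
    ((d.continuous_I l).stronglyMeasurableAtFilter _ _) (d.continuous_I l).continuousAt
  exact h.const_add _

theorem P_zero : d.P l 0 = firstMoment d.R d.ρ₀ := by simp [P]

theorem continuous_P : Continuous (d.P l) :=
  continuous_iff_continuousAt.2 fun t => (d.hasDerivAt_P l t).continuousAt

theorem hasDerivAt_P_apply (i : Fin 2) (t : ℝ) :
    HasDerivAt (fun t => d.P l t i) (d.I l t i) t :=
  (EuclideanSpace.proj i : Plane →L[ℝ] ℝ).hasFDerivAt.comp_hasDerivAt t (d.hasDerivAt_P l t)

end CauchyData

namespace SolvesCauchyProblem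

variable {l T t : ℝ} {d : CauchyData} {ρ p S : ℝ → Plane → ℝ} {u : ℝ → Plane → Plane}

theorem primitiveSolution (h : SolvesCauchyProblem 2 l T d ρ p S u) :
    PrimitiveSolution l T (fun z => ρ z.1 z.2) (fun z => p z.1 z.2) (fun z => S z.1 z.2)
      (fun z => u z.1 z.2 0) (fun z => u z.1 z.2 1) :=
  h.isClassicalSolution.primitiveSolution

theorem const_outside (h : SolvesCauchyProblem 2 l T d ρ p S u) (ht : t ∈ Icc 0 T) {x : Plane}
    (hx : x ∉ ball (0 : Plane) (d.radius 2 t)) :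
    (u t x 0, u t x 1, p t x, ρ t x) = (0, 0, d.pbar, d.ρbar) := by
  refine h.primitiveSolution.const_outside d.R_pos (fun x hx => ?_) ht hx
  simp [h.initial_density, h.initial_pressure, h.initial_velocity, d.ρ₀_outside x hx,
    d.p₀_outside x hx, d.u₀_outside x hx]

theorem density_outside (h : SolvesCauchyProblem 2 l T d ρ p S u) (ht : t ∈ Icc 0 T) (x : Plane)
    (hx : x ∉ ball (0 : Plane) (d.radius 2 t)) : ρ t x = d.ρbar := by
  have := h.const_outside ht hx
  simp only [Prod.mk.injEq] at this
  exact this.2.2.2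

theorem pressure_outside (h : SolvesCauchyProblem 2 l T d ρ p S u) (ht : t ∈ Icc 0 T) (x : Plane)
    (hx : x ∉ ball (0 : Plane) (d.radius 2 t)) : p t x = d.pbar := by
  have := h.const_outside ht hx
  simp only [Prod.mk.injEq] at this
  exact this.2.2.1

theorem velocity_outside (h : SolvesCauchyProblem 2 l T d ρ p S u) (ht : t ∈ Icc 0 T) (x : Plane)
    (hx : x ∉ ball (0 : Plane) (d.radius 2 t)) : u t x = 0 := by
  have := h.const_outside ht hx
  simp only [Prod.mk.injEq] at this
  ext i
  fin_cases i
  · exact this.1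
  · exact this.2.1

theorem const_outside_final (h : SolvesCauchyProblem 2 l T d ρ p S u) (ht : t ∈ Icc 0 T)
    {x : Plane} (hx : x ∉ closedBall (0 : Plane) (d.radius 2 T)) :
    (u t x 0, u t x 1, p t x, ρ t x) = (0, 0, d.pbar, d.ρbar) := by
  refine h.const_outside ht fun hx' => hx (ball_subset_closedBall (ball_subset_ball ?_ hx'))
  have := mul_le_mul_of_nonneg_left ht.2 d.soundSpeed_pos.le
  simp only [CauchyData.radius]
  linarith

theorem continuous_density (h : SolvesCauchyProblem 2 l T d ρ p S u) (ht : t ∈ Icc 0 T) :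
    Continuous (ρ t) :=
  (contDiff_slice_space h.isClassicalSolution.contDiff_density ht).continuous

theorem continuous_pressure (h : SolvesCauchyProblem 2 l T d ρ p S u) (ht : t ∈ Icc 0 T) :
    Continuous (p t) :=
  (contDiff_slice_space h.isClassicalSolution.contDiff_pressure ht).continuous

theorem continuous_velocity (h : SolvesCauchyProblem 2 l T d ρ p S u) (ht : t ∈ Icc 0 T) :
    Continuous (u t) := by
  rw [← continuousOn_univ]
  exact h.isClassicalSolution.contDiff_velocity.continuousOn.comp (f := fun x => (t, x))
    (by fun_prop) fun x _ => ⟨ht, mem_univ x⟩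

theorem mass_eq (h : SolvesCauchyProblem 2 l T d ρ p S u) (ht : t ∈ Icc 0 T) :
    ∫ x in ball (0 : Plane) (d.radius 2 t), ρ t x = d.mass 2 t := by
  obtain ⟨hc, hd⟩ := h.primitiveSolution.massExcess_balance (isCompact_closedBall 0 (d.radius 2 T))
    fun t ht x hx => h.const_outside_final ht hx
  have e := eq_left_of_hasDerivAt_zero hc hd t ht
  rw [setIntegral_density_eq (h.continuous_density ht) (d.radius_pos ht.1).le
    (h.density_outside ht)]
  simp only [h.initial_density] at e
  rw [e, CauchyData.mass, massExcess_eq d.ρ₀_outside]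

theorem energy_eq (h : SolvesCauchyProblem 2 l T d ρ p S u) (ht : t ∈ Icc 0 T) :
    ∫ x, (ρ t x * (u t x 0 ^ 2 + u t x 1 ^ 2) / 2 + (p t x - d.pbar))
      = totalEnergy 2 d.pbar d.R d.ρ₀ d.p₀ d.u₀ := by
  obtain ⟨hc, hd⟩ := h.primitiveSolution.energy_balance (isCompact_closedBall 0 (d.radius 2 T))
    fun t ht x hx => h.const_outside_final ht hx
  have e := eq_left_of_hasDerivAt_zero hc hd t ht
  simp only [h.initial_density, h.initial_pressure, h.initial_velocity] at e
  rw [totalEnergy_eq d.contDiff_ρ₀.continuous d.contDiff_p₀.continuous d.contDiff_u₀.continuous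
    d.p₀_outside d.u₀_outside, ← e]

theorem secondMoment_eq_G (h : SolvesCauchyProblem 2 l T d ρ p S u) (ht : t ∈ Icc 0 T) :
    secondMoment (d.radius 2 t) (ρ t) = d.G l t := by
  have hk := isCompact_closedBall (0 : Plane) (d.radius 2 T)
  have hout := fun t (ht : t ∈ Icc 0 T) x (hx : x ∉ closedBall (0 : Plane) (d.radius 2 T)) =>
    h.const_outside_final ht hx
  obtain ⟨cH, dH⟩ := h.primitiveSolution.secondMoment_balance hk hout
  obtain ⟨cF, dF⟩ := h.primitiveSolution.radialMomentum_balance hk hout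
  obtain ⟨cL, dL⟩ := h.primitiveSolution.angularMomentum_balance hk hout
  simp only [coord] at cH dH cF dF cL dL
  set H : ℝ → ℝ := fun t => ∫ x : Plane, (ρ t x - d.ρbar) * (x 0 ^ 2 + x 1 ^ 2) / 2 with hH
  set F : ℝ → ℝ := fun t => ∫ x : Plane, ρ t x * (u t x 0 * x 0 + u t x 1 * x 1) with hF
  set L : ℝ → ℝ := fun t => ∫ x : Plane, ρ t x * (u t x 0 * x 1 - u t x 1 * x 0) with hL
  have h0 : (0 : ℝ) ∈ Icc 0 T := left_mem_Icc.2 (ht.1.trans ht.2)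
  have hLH : ∀ t ∈ Icc 0 T, L t - l * H t = L 0 - l * H 0 :=
    eq_left_of_hasDerivAt_zero (cL.sub (cH.const_smul l)) fun t ht => by
      have := (dL t ht).fun_sub ((dH t ht).const_mul l)
      simpa using this
  have hF0 : F 0 = radialMomentum d.R d.ρ₀ d.u₀ := by
    rw [radialMomentum_eq d.u₀_outside, hF]
    simp only [h.initial_density, h.initial_velocity]
  have hL0 : L 0 = angularMomentum d.R d.ρ₀ d.u₀ := by
    rw [angularMomentum_eq d.u₀_outside, hL]
    simp only [h.initial_density, h.initial_velocity]
  have hH0 : secondMoment d.R d.ρ₀ = H 0 + d.ρbar * Real.pi * d.R ^ 4 / 4 := by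
    rw [secondMoment_eq d.contDiff_ρ₀.continuous d.R_pos.le d.ρ₀_outside, hH]
    simp only [h.initial_density]
  have hosc := eq_forcedOscillation (l := l) (A := d.A₀ 2 l)
    (Y := fun t => H t + d.ρbar * Real.pi * d.R ^ 4 / 4) (V := F) (cH.add continuousOn_const) cF
    (fun t ht => (dH t ht).add_const _) (fun t ht => ?_) t ht
  · rw [secondMoment_eq (h.continuous_density ht) (d.radius_pos ht.1).le (h.density_outside ht),
      d.G_eq, ← hF0, hH0]
    change H t + _ = _
    rw [← hosc]
    ring
  · refine (dF t ht).congr_deriv ?_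
    have hE := h.energy_eq (Ioo_subset_Icc_self ht)
    have hLt := hLH t (Ioo_subset_Icc_self ht)
    rw [hE, CauchyData.A₀, hH0, ← hL0]
    change _ - l * L t = _
    linear_combination -l * hLt

theorem firstMoment_eq_P (h : SolvesCauchyProblem 2 l T d ρ p S u) (ht : t ∈ Icc 0 T) :
    firstMoment (d.radius 2 t) (ρ t) = d.P l t := by
  have hk := isCompact_closedBall (0 : Plane) (d.radius 2 T)
  have hout := fun t (ht : t ∈ Icc 0 T) x (hx : x ∉ closedBall (0 : Plane) (d.radius 2 T)) =>
    h.const_outside_final ht hx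
  obtain ⟨c0, d0⟩ := h.primitiveSolution.momentum_balance₀ hk hout
  obtain ⟨c1, d1⟩ := h.primitiveSolution.momentum_balance₁ hk hout
  have hrot := eq_rotation c0 c1 d0 d1
  simp only [h.initial_density, h.initial_velocity] at hrot
  have hI : ∀ i, ∫ x, d.ρ₀ x * d.u₀ x i = totalMomentum d.R d.ρ₀ d.u₀ i := fun i =>
    (totalMomentum_eq d.contDiff_ρ₀.continuous d.contDiff_u₀.continuous d.u₀_outside i).symm
  simp only [hI] at hrot
  have hmain : ∀ i, (∀ t ∈ Ioo 0 T, ∫ x, ρ t x * (basisVec 0 i * u t x 0 + basisVec 1 i * u t x 1)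
      = d.I l t i) → firstMoment (d.radius 2 t) (ρ t) i = d.P l t i := by
    intro i hi
    obtain ⟨cP, dP⟩ := h.primitiveSolution.firstMoment_balance hk hout i
    simp only [coord] at cP dP
    have hc : ContinuousOn (fun t => d.P l t i) (Icc 0 T) :=
      (continuous_iff_continuousAt.2 fun t => (d.hasDerivAt_P_apply l i t).continuousAt).continuousOn
    have e := eq_left_of_hasDerivAt_zero (cP.sub hc) (fun t ht => by
      have := (dP t ht).sub (d.hasDerivAt_P_apply l i t)
      rwa [hi t ht, sub_self] at this) t ht
    rw [firstMoment_eq (h.continuous_density ht) (h.density_outside ht)]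
    simp only [Pi.sub_apply, h.initial_density, d.P_zero,
      firstMoment_eq d.contDiff_ρ₀.continuous d.ρ₀_outside] at e
    linarith
  ext i
  fin_cases i
  · refine hmain 0 fun t ht => ?_
    rw [d.I_zero, ← (hrot t (Ioo_subset_Icc_self ht)).1]
    simp
  · refine hmain 1 fun t ht => ?_
    rw [d.I_one, ← (hrot t (Ioo_subset_Icc_self ht)).2]
    simp

end SolvesCauchyProblem

/-- A density which is bounded in `L²` cannot concentrate on the zero set of the weight `w`. -/
theorem integral_le_of_weight {f w : Plane → ℝ} {R ε δ : ℝ} (hf : Continuous f)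
    (hw : Continuous w) (hf0 : ∀ x, 0 ≤ f x) (hw0 : ∀ x ∈ ball (0 : Plane) R, 0 ≤ w x) (hε : 0 < ε)
    (hδ : 0 < δ)
    (hvol : volume.real {x | x ∈ ball (0 : Plane) R ∧ w x < ε} ≤ Real.pi * ε) :
    ∫ x in ball (0 : Plane) R, f x ≤ ε⁻¹ * (∫ x in ball (0 : Plane) R, w x * f x)
      + δ / 2 * (∫ x in ball (0 : Plane) R, f x ^ 2) + Real.pi * ε / (2 * δ) := by
  set A : Set Plane := {x | x ∈ ball (0 : Plane) R ∧ w x < ε} with hA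
  have hAm : MeasurableSet A :=
    (isOpen_ball.inter (isOpen_lt hw continuous_const)).measurableSet
  have i1 := (integrableOn_ball (g := fun x => w x * f x) (by fun_prop) 0 R).const_mul ε⁻¹
  have i2 := (integrableOn_ball (g := fun x => f x ^ 2) (by fun_prop) 0 R).const_mul (δ / 2)
  have i3 : IntegrableOn (A.indicator fun _ => (2 * δ)⁻¹) (ball (0 : Plane) R) :=
    (integrableOn_ball continuous_const 0 R).indicator hAm
  have h3 : ∫ x in ball (0 : Plane) R, A.indicator (fun _ => (2 * δ)⁻¹) x
      ≤ Real.pi * ε / (2 * δ) := by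
    rw [setIntegral_indicator hAm, inter_eq_right.2 (fun x hx => hx.1), setIntegral_const,
      smul_eq_mul, ← div_eq_mul_inv]
    gcongr
  have hmono : ∫ x in ball (0 : Plane) R, f x ≤ ∫ x in ball (0 : Plane) R,
      (ε⁻¹ * (w x * f x) + δ / 2 * f x ^ 2 + A.indicator (fun _ => (2 * δ)⁻¹) x) := by
    refine setIntegral_mono_on (integrableOn_ball hf 0 R) ((i1.add i2).add i3) measurableSet_ball
      fun x hx => ?_
    by_cases hxA : x ∈ A
    · rw [indicator_of_mem hxA]
      have h1 : 0 ≤ ε⁻¹ * (w x * f x) :=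
        mul_nonneg (inv_nonneg.2 hε.le) (mul_nonneg (hw0 x hx) (hf0 x))
      have h2 : δ / 2 * f x ^ 2 + (2 * δ)⁻¹ - f x = (δ * f x - 1) ^ 2 / (2 * δ) := by
        field_simp
        ring
      have h3 : 0 ≤ (δ * f x - 1) ^ 2 / (2 * δ) := by positivity
      linarith
    · rw [indicator_of_notMem hxA]
      have hwx : ε ≤ w x := not_lt.1 fun h => hxA ⟨hx, h⟩
      have h1 : f x ≤ ε⁻¹ * (w x * f x) := by
        rw [inv_mul_eq_div, le_div_iff₀ hε, mul_comm]
        exact mul_le_mul_of_nonneg_right hwx (hf0 x)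
      have h2 : 0 ≤ δ / 2 * f x ^ 2 := by positivity
      linarith
  refine hmono.trans ?_
  have i12 : IntegrableOn (fun x => ε⁻¹ * (w x * f x) + δ / 2 * f x ^ 2) (ball (0 : Plane) R) :=
    i1.add i2
  rw [integral_add i12 i3, integral_add i1 i2, integral_const_mul, integral_const_mul]
  linarith

theorem volume_boundaryLayer_le {R ε : ℝ} (hR : 0 ≤ R) (hε : 0 ≤ ε) (hεR : ε ≤ R ^ 2) :
    volume.real {x | x ∈ ball (0 : Plane) R ∧ R ^ 2 - ‖x‖ ^ 2 < ε} ≤ Real.pi * ε := by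
  have hs : 0 ≤ R ^ 2 - ε := by linarith
  have hsub : {x | x ∈ ball (0 : Plane) R ∧ R ^ 2 - ‖x‖ ^ 2 < ε}
      ⊆ ball 0 R \ ball 0 (Real.sqrt (R ^ 2 - ε)) := fun x hx => by
    refine ⟨hx.1, fun h => ?_⟩
    rw [mem_ball_zero_iff, Real.lt_sqrt (norm_nonneg x)] at h
    linarith [hx.2]
  refine (measureReal_mono hsub ((measure_mono sdiff_subset).trans_lt measure_ball_lt_top).ne).trans ?_
  rw [measureReal_sdiff (ball_subset_ball (Real.sqrt_le_left hR |>.2 (by linarith)))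
    measurableSet_ball, volume_real_ball 0 hR, volume_real_ball 0 (Real.sqrt_nonneg _),
    Real.sq_sqrt hs]
  linarith

theorem volume_disc_le (c : Plane) {R ε : ℝ} (hε : 0 ≤ ε) :
    volume.real {x | x ∈ ball (0 : Plane) R ∧ ‖x - c‖ ^ 2 < ε} ≤ Real.pi * ε := by
  have hsub : {x | x ∈ ball (0 : Plane) R ∧ ‖x - c‖ ^ 2 < ε} ⊆ ball c (Real.sqrt ε) :=
    fun x hx => by
      rw [mem_ball, dist_eq_norm, Real.lt_sqrt (norm_nonneg _)]
      exact hx.2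
  refine (measureReal_mono hsub measure_ball_lt_top.ne).trans ?_
  rw [volume_real_ball c (Real.sqrt_nonneg _), Real.sq_sqrt hε]

namespace CauchyData

variable (d : CauchyData) (l : ℝ)

theorem exists_entropy_bound : ∃ κ > 0, ∀ x, κ * d.ρ₀ x ^ 2 ≤ d.p₀ x := by
  have hc : Continuous fun x => d.p₀ x / d.ρ₀ x ^ 2 :=
    d.contDiff_p₀.continuous.div (d.contDiff_ρ₀.continuous.pow 2)
      fun x => (pow_pos (d.ρ₀_pos x) 2).ne'
  obtain ⟨y, -, hy⟩ := (isCompact_closedBall (0 : Plane) d.R).exists_isMinOn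
    ⟨0, mem_closedBall_self d.R_pos.le⟩ hc.continuousOn
  have h1 := d.ρbar_pos
  have h2 := d.pbar_pos
  have h3 := d.ρ₀_pos y
  have h4 := d.p₀_pos y
  refine ⟨min (d.p₀ y / d.ρ₀ y ^ 2) (d.pbar / d.ρbar ^ 2), by positivity, fun x => ?_⟩
  have h5 := d.ρ₀_pos x
  rw [← le_div_iff₀ (by positivity)]
  by_cases hx : x ∈ ball (0 : Plane) d.R
  · exact (min_le_left _ _).trans (hy (ball_subset_closedBall hx))
  · rw [d.ρ₀_outside x hx, d.p₀_outside x hx]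
    exact min_le_right _ _

theorem mass_zero_pos : 0 < d.mass 2 0 := by
  have h : d.mass 2 0 = ∫ x in ball (0 : Plane) d.R, d.ρ₀ x := by
    rw [setIntegral_density_eq d.contDiff_ρ₀.continuous d.R_pos.le d.ρ₀_outside, mass,
      massExcess_eq d.ρ₀_outside, radius_zero]
  rw [h, setIntegral_pos_iff_support_of_nonneg_ae (ae_of_all _ fun x => (d.ρ₀_pos x).le)
    (integrableOn_ball d.contDiff_ρ₀.continuous 0 d.R)]
  have hs : Function.support d.ρ₀ = univ := by
    ext x; simp [(d.ρ₀_pos x).ne']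
  rw [hs, univ_inter]
  exact measure_ball_pos _ _ d.R_pos

theorem radius_mono {s t : ℝ} (hst : s ≤ t) : d.radius 2 s ≤ d.radius 2 t := by
  have := mul_le_mul_of_nonneg_left hst d.soundSpeed_pos.le
  simp only [radius]
  linarith

theorem mass_mono {s t : ℝ} (hs : 0 ≤ s) (hst : s ≤ t) : d.mass 2 s ≤ d.mass 2 t := by
  have h1 := (d.radius_pos hs).le
  have h2 := d.radius_mono hst
  have h3 := d.ρbar_pos
  have h4 := Real.pi_pos
  simp only [mass]
  gcongr

theorem mass_pos {t : ℝ} (ht : 0 ≤ t) : 0 < d.mass 2 t :=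
  d.mass_zero_pos.trans_le (d.mass_mono le_rfl ht)

theorem continuous_radius : Continuous (d.radius 2) := by
  unfold radius; fun_prop

theorem continuous_mass : Continuous (d.mass 2) := by
  have := d.continuous_radius
  unfold mass
  fun_prop

theorem continuous_φupper : Continuous (d.φupper 2) := by
  have := d.continuous_radius
  have := d.continuous_mass
  simp only [funext fun t => show d.φupper 2 t = d.radius 2 t ^ 2 / 2 * d.mass 2 t from rfl]
  fun_prop

theorem continuousAt_φlower {t : ℝ} (ht : 0 ≤ t) : ContinuousAt (d.φlower 2 l) t := by
  have h1 := d.continuous_P l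
  have h2 := d.continuous_mass
  have h3 := d.mass_pos ht
  exact ContinuousAt.div (f := fun t => ‖d.P l t‖ ^ 2) (g := fun t => 2 * d.mass 2 t)
    (by fun_prop) (by fun_prop) (by positivity)

theorem continuous_G : Continuous (d.G l) := by
  have h1 := d.continuous_radius
  have h2 := continuous_iff_continuousAt.2 fun t => (hasDerivAt_forcedOscillation l
    (secondMoment d.R d.ρ₀) (radialMomentum d.R d.ρ₀ d.u₀) (d.A₀ 2 l) t).continuousAt
  rw [funext (d.G_eq l)]
  fun_prop

end CauchyData

namespace SolvesCauchyProblem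

variable {l T t : ℝ} {d : CauchyData} {ρ p S : ℝ → Plane → ℝ} {u : ℝ → Plane → Plane}

theorem density_sq_le_pressure (h : SolvesCauchyProblem 2 l T d ρ p S u) {κ : ℝ} (hκ : 0 < κ)
    (hd : ∀ x, κ * d.ρ₀ x ^ 2 ≤ d.p₀ x) (ht : t ∈ Icc 0 T) (x : Plane) :
    κ * ρ t x ^ 2 ≤ p t x := by
  have hp := h.primitiveSolution
  have key : ∀ t ∈ Icc 0 T, ∀ x, κ * ρ t x ^ 2 ≤ p t x ↔ Real.log κ ≤ S t x := fun t ht x => by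
    have h1 := hp.r_pos t ht x
    have h2 := hp.state t ht x
    simp only at h1 h2
    rw [h2, mul_le_mul_iff_of_pos_right (by positivity), Real.log_le_iff_le_exp hκ]
  have h0 : (0 : ℝ) ∈ Icc 0 T := left_mem_Icc.2 (ht.1.trans ht.2)
  refine (key t ht x).2 (hp.entropy_ge (isCompact_closedBall 0 (d.radius 2 T)) ?_ ?_ t ht x)
  · intro t ht x hx
    have e := h.const_outside_final ht hx
    simp only [Prod.mk.injEq] at e
    refine (key t ht x).1 ?_
    have hb : d.R • basisVec 0 ∉ ball (0 : Plane) d.R := by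
      simp [norm_smul, basisVec, abs_of_pos d.R_pos]
    rw [e.2.2.1, e.2.2.2, ← d.ρ₀_outside _ hb, ← d.p₀_outside _ hb]
    exact hd _
  · intro x
    refine (key 0 h0 x).1 ?_
    rw [h.initial_density, h.initial_pressure]
    exact hd x

theorem integral_density_sq_le (h : SolvesCauchyProblem 2 l T d ρ p S u) {κ : ℝ} (hκ : 0 < κ)
    (hd : ∀ x, κ * d.ρ₀ x ^ 2 ≤ d.p₀ x) (ht : t ∈ Icc 0 T) :
    κ * ∫ x in ball (0 : Plane) (d.radius 2 t), ρ t x ^ 2 ≤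
      totalEnergy 2 d.pbar d.R d.ρ₀ d.p₀ d.u₀ + d.pbar * (Real.pi * d.radius 2 t ^ 2) := by
  have cρ := h.continuous_density ht
  have cp := h.continuous_pressure ht
  have cu := h.continuous_velocity ht
  have c0 : Continuous fun x => u t x 0 := (continuous_coord_apply 0).comp cu
  have c1 : Continuous fun x => u t x 1 := (continuous_coord_apply 1).comp cu
  have ce : Continuous fun x => ρ t x * (u t x 0 ^ 2 + u t x 1 ^ 2) / 2 + (p t x - d.pbar) := by
    fun_prop
  have hE := h.energy_eq ht
  rw [← setIntegral_ball_eq_integral (R := d.radius 2 t) fun x hx => by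
    simp [h.velocity_outside ht x hx, h.pressure_outside ht x hx]] at hE
  rw [← hE, ← volume_real_ball (0 : Plane) (d.radius_pos ht.1).le, mul_comm d.pbar, ← smul_eq_mul,
    ← smul_eq_mul (volume.real _), ← setIntegral_const, ← integral_smul,
    ← integral_add (integrableOn_ball ce 0 _) (integrableOn_ball continuous_const 0 _)]
  refine setIntegral_mono (integrableOn_ball (by fun_prop) 0 _)
    ((integrableOn_ball ce 0 _).add (integrableOn_ball continuous_const 0 _)) fun x => ?_
  have h1 := h.density_sq_le_pressure hκ hd ht x
  have h2 := h.isClassicalSolution.density_pos t ht x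
  have h3 : 0 ≤ ρ t x * (u t x 0 ^ 2 + u t x 1 ^ 2) / 2 := by positivity
  simp only [smul_eq_mul]
  linarith

theorem φupper_sub_G (h : SolvesCauchyProblem 2 l T d ρ p S u) (ht : t ∈ Icc 0 T) :
    d.φupper 2 t - d.G l t
      = 1 / 2 * ∫ x in ball (0 : Plane) (d.radius 2 t), (d.radius 2 t ^ 2 - ‖x‖ ^ 2) * ρ t x := by
  have cρ := h.continuous_density ht
  rw [← h.secondMoment_eq_G ht, CauchyData.φupper, ← h.mass_eq ht, secondMoment]
  simp only [sub_mul]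
  rw [integral_sub (integrableOn_ball (by fun_prop) 0 _) (integrableOn_ball (by fun_prop) 0 _),
    integral_const_mul]
  ring

theorem G_sub_φlower (h : SolvesCauchyProblem 2 l T d ρ p S u) (ht : t ∈ Icc 0 T) :
    d.G l t - d.φlower 2 l t = 1 / 2 * ∫ x in ball (0 : Plane) (d.radius 2 t),
      ‖x - (d.mass 2 t)⁻¹ • d.P l t‖ ^ 2 * ρ t x := by
  have cρ := h.continuous_density ht
  have c0 := continuous_coord_apply 0
  have c1 := continuous_coord_apply 1
  have hM := d.mass_pos ht.1
  set c := (d.mass 2 t)⁻¹ • d.P l t with hc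
  have hP : ∀ i, ∫ x in ball (0 : Plane) (d.radius 2 t), ρ t x * x i = d.P l t i := fun i => by
    rw [← h.firstMoment_eq_P ht, firstMoment_apply cρ]
  have e : ∫ x in ball (0 : Plane) (d.radius 2 t), ‖x - c‖ ^ 2 * ρ t x
      = ∫ x in ball (0 : Plane) (d.radius 2 t), (‖x‖ ^ 2 * ρ t x
        - (2 * c 0 * (ρ t x * x 0) + 2 * c 1 * (ρ t x * x 1)) + ‖c‖ ^ 2 * ρ t x) := by
    congr 1 with x
    rw [norm_sq_eq_coord, norm_sq_eq_coord, norm_sq_eq_coord]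
    simp only [PiLp.sub_apply]
    ring
  have i := fun {g : Plane → ℝ} (hg : Continuous g) => integrableOn_ball hg 0 (d.radius 2 t)
  rw [e, integral_add (i (by fun_prop)) (i (by fun_prop)),
    integral_sub (i (by fun_prop)) (i (by fun_prop)),
    integral_add (i (by fun_prop)) (i (by fun_prop)), integral_const_mul, integral_const_mul,
    integral_const_mul, hP, hP, h.mass_eq ht, ← h.secondMoment_eq_G ht, CauchyData.φlower,
    secondMoment, norm_sq_eq_coord, norm_sq_eq_coord, hc]
  simp only [PiLp.smul_apply, smul_eq_mul]
  field_simp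
  ring

end SolvesCauchyProblem

/-- Up to any fixed time, solutions keep a uniform distance from both bounds. -/
theorem exists_uniform_gap (l : ℝ) (d : CauchyData) (Tstar : ℝ) :
    ∃ c > 0, ∀ T, 0 < T → T < Tstar → (∃ ρ p S u, SolvesCauchyProblem 2 l T d ρ p S u) →
      d.φlower 2 l T + c ≤ d.G l T ∧ d.G l T + c ≤ d.φupper 2 T := by
  obtain ⟨κ, hκ, hκd⟩ := d.exists_entropy_bound
  set M := d.mass 2 0 with hMdef
  have hM : 0 < M := d.mass_zero_pos
  set C := |totalEnergy 2 d.pbar d.R d.ρ₀ d.p₀ d.u₀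
    + d.pbar * (Real.pi * d.radius 2 Tstar ^ 2)| / κ + 1 with hC
  have hCpos : 0 < C := by positivity
  set δ := M / (2 * C) with hδ
  have hδpos : 0 < δ := by positivity
  set ε := min (d.R ^ 2) (δ * M / (2 * Real.pi)) with hε
  have hεpos : 0 < ε := lt_min (pow_pos d.R_pos 2) (div_pos (mul_pos hδpos hM) (by positivity))
  refine ⟨ε * M / 4, by positivity, ?_⟩
  rintro T hT0 hTT ⟨ρ, p, S, u, h⟩
  have ht : T ∈ Icc 0 T := right_mem_Icc.2 hT0.le
  have hsq : ∫ x in ball (0 : Plane) (d.radius 2 T), ρ T x ^ 2 ≤ C := by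
    have h1 := h.integral_density_sq_le hκ hκd ht
    have h2 : d.pbar * (Real.pi * d.radius 2 T ^ 2)
        ≤ d.pbar * (Real.pi * d.radius 2 Tstar ^ 2) := by
      have := d.radius_mono hTT.le
      have := (d.radius_pos hT0.le).le
      have := d.pbar_pos
      have := Real.pi_pos
      gcongr
    have h3 := le_abs_self (totalEnergy 2 d.pbar d.R d.ρ₀ d.p₀ d.u₀
      + d.pbar * (Real.pi * d.radius 2 Tstar ^ 2))
    rw [mul_comm, ← le_div_iff₀ hκ] at h1
    refine h1.trans ((div_le_div_of_nonneg_right ?_ hκ.le).trans (le_add_of_nonneg_right zero_le_one))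
    linarith
  have hgap : ∀ w : Plane → ℝ, Continuous w →
      (∀ x ∈ ball (0 : Plane) (d.radius 2 T), 0 ≤ w x) →
      volume.real {x | x ∈ ball (0 : Plane) (d.radius 2 T) ∧ w x < ε} ≤ Real.pi * ε →
      ε * M / 2 ≤ ∫ x in ball (0 : Plane) (d.radius 2 T), w x * ρ T x := by
    intro w hw hw0 hvol
    have h1 := integral_le_of_weight (h.continuous_density ht) hw
      (fun x => (h.isClassicalSolution.density_pos T ht x).le) hw0 hεpos hδpos hvol
    rw [h.mass_eq ht] at h1
    have h2 := d.mass_mono le_rfl hT0.le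
    have h3 : δ / 2 * ∫ x in ball (0 : Plane) (d.radius 2 T), ρ T x ^ 2 ≤ M / 4 := by
      calc _ ≤ δ / 2 * C := by gcongr
        _ = M / 4 := by rw [hδ]; field_simp; norm_num
    have h4 : Real.pi * ε / (2 * δ) ≤ M / 4 := by
      have hp := Real.pi_pos
      have h5 : ε ≤ δ * M / (2 * Real.pi) := min_le_right _ _
      rw [le_div_iff₀ (by positivity)] at h5
      rw [div_le_iff₀ (by positivity)]
      linarith
    have h6 : M / 2 ≤ ε⁻¹ * ∫ x in ball (0 : Plane) (d.radius 2 T), w x * ρ T x := by linarith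
    rw [inv_mul_eq_div, le_div_iff₀ hεpos] at h6
    linarith
  constructor
  · have h1 := hgap (fun x => ‖x - (d.mass 2 T)⁻¹ • d.P l T‖ ^ 2) (by fun_prop)
      (fun x _ => sq_nonneg _) (volume_disc_le _ hεpos.le)
    have h2 := h.G_sub_φlower ht
    linarith
  · have hr := d.R_le_radius hT0.le
    have h1 := hgap (fun x => d.radius 2 T ^ 2 - ‖x‖ ^ 2) (by fun_prop)
      (fun x hx => by
        rw [mem_ball_zero_iff] at hx
        nlinarith [norm_nonneg x])
      (volume_boundaryLayer_le (d.radius_pos hT0.le).le hεpos.le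
        ((min_le_left _ _).trans (pow_le_pow_left₀ d.R_pos.le hr 2)))
    have h2 := h.φupper_sub_G ht
    linarith

/-- If `G` meets one of its bounds at time `Tstar`, solutions cannot exist on all `[0, T]` with
`T < Tstar`. -/
theorem exists_not_solvable (l : ℝ) (d : CauchyData) {Tstar : ℝ} (hT : 0 < Tstar)
    (heq : d.G l Tstar = d.φlower 2 l Tstar ∨ d.G l Tstar = d.φupper 2 Tstar) :
    ∃ T : ℝ, 0 < T ∧ T < Tstar ∧ ¬ ∃ ρ p S u, SolvesCauchyProblem 2 l T d ρ p S u := by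
  by_contra! hsol
  obtain ⟨c, hc, hgap⟩ := exists_uniform_gap l d Tstar
  have hev : ∀ᶠ T in 𝓝[<] Tstar, d.φlower 2 l T + c ≤ d.G l T ∧ d.G l T + c ≤ d.φupper 2 T := by
    filter_upwards [Ioo_mem_nhdsLT hT] with T hTm
    exact hgap T hTm.1 hTm.2 (hsol T hTm.1 hTm.2)
  have hG := ((d.continuous_G l).tendsto Tstar).mono_left (nhdsWithin_le_nhds (s := Iio Tstar))
  have hlow := (d.continuousAt_φlower l hT.le).tendsto.mono_left
    (nhdsWithin_le_nhds (s := Iio Tstar))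
  have hup := (d.continuous_φupper.tendsto Tstar).mono_left (nhdsWithin_le_nhds (s := Iio Tstar))
  have h1 := le_of_tendsto_of_tendsto (hlow.add_const c) hG (hev.mono fun _ h => h.1)
  have h2 := le_of_tendsto_of_tendsto (hG.add_const c) hup (hev.mono fun _ h => h.2)
  rcases heq with h | h <;> linarith

end RotatingGas

theorem theorem1 (l : ℝ) (hl : 0 ≤ l) (d : RotatingGas.CauchyData) :
    (∀ (T : ℝ) (ρ p S : ℝ → RotatingGas.Plane → ℝ)
        (u : ℝ → RotatingGas.Plane → RotatingGas.Plane),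
        0 < T → RotatingGas.SolvesCauchyProblem 2 l T d ρ p S u →
        ∀ t ∈ Set.Icc 0 T,
          RotatingGas.secondMoment (d.radius 2 t) (ρ t) = d.G l t ∧
          RotatingGas.firstMoment (d.radius 2 t) (ρ t) = d.P l t) ∧
    (∀ Tstar : ℝ, 0 < Tstar →
        (d.G l Tstar = d.φlower 2 l Tstar ∨ d.G l Tstar = d.φupper 2 Tstar) →
        ∃ T : ℝ, 0 < T ∧ T < Tstar ∧
          ¬ ∃ (ρ p S : ℝ → RotatingGas.Plane → ℝ)
              (u : ℝ → RotatingGas.Plane → RotatingGas.Plane),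
              RotatingGas.SolvesCauchyProblem 2 l T d ρ p S u) := by
  exact ⟨fun T ρ p S u _ h t ht => ⟨h.secondMoment_eq_G ht, h.firstMoment_eq_P ht⟩,
    fun Tstar hT heq => RotatingGas.exists_not_solvable l d hT heq⟩
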